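/- **Setting.** Let $T\in(0,\infty)$, $m,d,r\in\mathbb N$, let $D\subseteq\mathbb R^d$ be open and connected, and let $(\Omega,\mathcal F,\mathbb F=(\mathcal F_t)_{t\in[0,T]},P)$ be a filtered probability space satisfying the usual conditions, with $\mathcal F_0$ trivial. Let $\Gamma:[0,T]\times D\times\{1,\dots,m\}\to\mathbb R^d$, $\Sigma:[0,T]\times D\times\{1,\dots,m\}\to\mathbb R^{d\times r}$ and $\lambda^{kj}:[0,T]\times D\to[0,\infty)$ $(k,j=1,\dots,m)$ be $C^1$ in $(t,x)$, with all $\lambda^{kj}$ bounded. Let $W$ be an $\mathbb R^r$-valued $(P,\mathbb F)$-Brownian motion, let $N=(N^{kj})_{k,j=1,\dots,m}$ be an $\mathbb F$-adapted multivariate point process (identified with its counting processes, without common jumps), and let $(S,\eta)$ be an adapted process with values in $D\times\{1,\dots,m\}$, $S$ continuous and $\eta$ right-continuous with left limits, such that $$dS_t=\Gamma(t,S_t,\eta_{t-})\,dt+\Sigma(t,S_t,\eta_{t-})\,dW_t,\qquad d\eta_t=\sum_{k,j=1}^m (j-k)\,1_{\{\eta_{t-}=k\}}\,dN^{kj}_t,$$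 and such that $N^{kj}$ has $(P,\mathbb F)$-intensity $\lambda^{kj}(t,S_t)$, i.e. $N^{kj}-\int_0^{\cdot}\lambda^{kj}(t,S_t)\,dt$ is a $(P,\mathbb F)$-martingale, for all $k,j$. Assume that $\Sigma\Sigma^{\rm tr}$ is invertible on $[0,T]\times D\times\{1,\dots,m\}$ and that $\Phi:=\Sigma^{\rm tr}(\Sigma\Sigma^{\rm tr})^{-1}\Gamma$ is bounded there, and define the minimal martingale measure $\widehat P$ by $$d\widehat P=\widehat Z_T\,dP,\qquad \widehat Z=\mathcal E\Big(-\int\Phi(t,S_t,\eta_{t-})\,dW_t\Big),$$ where $\mathcal E(X)=\exp(X-\tfrac12[X])$ denotes the stochastic exponential of a continuous local martingale $X$ with $X_0=0$. A *payoff triple* $(h,\delta,f^{kj})$ consists of functions $h:D\times\{1,\dots,m\}\to\mathbb R$, $\delta:[0,T]\times D\times\{1,\dots,m\}\times\mathbb R\to\mathbb R$ and $f^{kj}:[0,T]\times D\times\mathbb R\to\mathbb R$ $(k,j=1,\dots,m)$ such that all of them are continuous; $h$ is bounded; there is $K<\infty$ with $|\delta(t,x,k,v)|,|f^{kj}(t,x,v)|\le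 K(1+|v|)$ for all $t,x,k,j,v$; and each $\delta(\cdot,\cdot,k,\cdot)$ and each $f^{kj}$ is $C^1$ in $(t,x,v)$ and locally Lipschitz-continuous in $v$, uniformly in $(t,x)\in[0,T]\times D$. **Lemma 4.3.** For any payoff triple $(h,\delta,f^{kj})$ and any $Q\in\{P,\widehat P\}$ there is, up to indistinguishability, at most one bounded semimartingale $V$ (with right-continuous paths with left limits) such that, for every $t\in[0,T]$, almost surely $$V_t=E_Q\Big[h(S_T,\eta_T)+\int_t^T\delta(u,S_u,\eta_{u-},V_{u-})\,du+\int_t^T\sum_{\substack{k,j=1\\k\ne j}}^m f^{kj}(u,S_u,V_{u-})\,1_{\{\eta_{u-}=k\}}\,dN^{kj}_u\,\Big|\,\mathcal F_t\Big].$$ That is, if $V^1$ and $V^2$ are two such processes, then almost surely $V^1_t=V^2_t$ for all $t\in[0,T]$. -/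

import Mathlib

open MeasureTheory ProbabilityTheory Filter Topology

namespace RecursiveClaim

/-! ### Time, paths and filtrations -/

/-- The time interval `[0, T]`; its least element `⊥` is `0` and its greatest element `⊤` is `T`.
On this type `Function.leftLim` has the usual convention `x(0-) = x(0)`. -/
abbrev Time (T : ℝ) : Type := Set.Icc (0 : ℝ) T

instance fact_le_of_lt (T : ℝ) [h : Fact (0 < T)] : Fact ((0 : ℝ) ≤ T) := ⟨h.out.le⟩

/-- Lebesgue measure on `[0, T]`. -/
noncomputable instance timeMeasureSpace (T : ℝ) : MeasureSpace (Time T) :=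
  Measure.Subtype.measureSpace

/-- All paths are right-continuous with left limits. -/
def IsRCLL {T : ℝ} {Ω E : Type*} [TopologicalSpace E] (X : Time T → Ω → E) : Prop :=
  ∀ ω, ∀ t : Time T, ContinuousWithinAt (fun s => X s ω) (Set.Ici t) t ∧
    ∃ l : E, Tendsto (fun s => X s ω) (𝓝[<] t) (𝓝 l)

/-- The process `X_{t-}` of left limits (with `X_{0-} = X_0`). -/
noncomputable def leftProcess {T : ℝ} {Ω E : Type*} [TopologicalSpace E]
    (X : Time T → Ω → E) (t : Time T) (ω : Ω) : E :=
  Function.leftLim (fun s => X s ω) t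

/-- The usual conditions (right-continuity, and `𝓕 0` contains all `P`-null sets), together with
triviality of `𝓕 0`. -/
structure UsualConditionsTrivial {T : ℝ} [Fact (0 < T)] {Ω : Type*} {mΩ : MeasurableSpace Ω}
    (𝓕 : Filtration (Time T) mΩ) (P : Measure Ω) : Prop where
  rightCont : 𝓕.IsRightContinuous
  complete : ∀ A : Set Ω, P A = 0 → MeasurableSet[𝓕 ⊥] A
  trivial_zero : ∀ A : Set Ω, MeasurableSet[𝓕 ⊥] A → P A = 0 ∨ P A = 1

/-! ### Semimartingales -/

/-- RCLL local martingales on `[0, T]`. -/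
def IsLocalMartingale {T : ℝ} [Fact (0 < T)] {Ω : Type*} {mΩ : MeasurableSpace Ω}
    (𝓕 : Filtration (Time T) mΩ) (P : Measure Ω) (M : Time T → Ω → ℝ) : Prop :=
  IsRCLL M ∧ StronglyAdapted 𝓕 M ∧ Locally (fun Y => Martingale Y 𝓕 P) 𝓕 M P

/-- Semimartingales: sums of an RCLL local martingale and an RCLL adapted process with paths of
finite variation on `[0, T]`. -/
def IsSemimartingale {T : ℝ} [Fact (0 < T)] {Ω : Type*} {mΩ : MeasurableSpace Ω}
    (𝓕 : Filtration (Time T) mΩ) (P : Measure Ω) (V : Time T → Ω → ℝ) : Prop :=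
  ∃ M A : Time T → Ω → ℝ, IsLocalMartingale 𝓕 P M ∧
    (IsRCLL A ∧ StronglyAdapted 𝓕 A ∧ ∀ ω, BoundedVariationOn (fun t => A t ω) Set.univ) ∧
    ∀ t ω, V t ω = M t ω + A t ω

/-- `V` is bounded, uniformly in time, up to a null set of paths. -/
def IsBoundedProcess {T : ℝ} {Ω : Type*} {mΩ : MeasurableSpace Ω}
    (P : Measure Ω) (V : Time T → Ω → ℝ) : Prop :=
  ∃ K : ℝ, ∀ᵐ ω ∂P, ∀ t, |V t ω| ≤ K

/-! ### Brownian motion and the stochastic integral -/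

/-- `ℝ^r`-valued `(P, 𝓕)`-Brownian motion on `[0, T]`. -/
structure IsBrownianMotion {T : ℝ} [Fact (0 < T)] {Ω : Type*} {mΩ : MeasurableSpace Ω} {r : ℕ}
    (𝓕 : Filtration (Time T) mΩ) (P : Measure Ω) (W : Time T → Ω → Fin r → ℝ) : Prop where
  adapted : StronglyAdapted 𝓕 W
  zero : ∀ᵐ ω ∂P, W ⊥ ω = 0
  continuous : ∀ ω, Continuous fun t => W t ω
  indep : ∀ s t : Time T, s ≤ t →
    Indep (MeasurableSpace.comap (fun ω => W t ω - W s ω) inferInstance) (𝓕 s) P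
  law : ∀ s t : Time T, s ≤ t →
    P.map (fun ω => W t ω - W s ω) =
      Measure.pi fun _ : Fin r => gaussianReal 0 (Real.toNNReal ((t : ℝ) - s))

/-- Finite partitions `0 = pt 0 ≤ pt 1 ≤ … ≤ pt n = T`. -/
structure TimePartition (T : ℝ) [Fact (0 < T)] where
  n : ℕ
  pt : ℕ → Time T
  mono : Monotone pt
  first : pt 0 = ⊥
  last : pt n = ⊤

/-- The Riemann sum `∑_i H_{t_i} · (W_{t_{i+1} ∧ t} - W_{t_i ∧ t})` along a partition. -/
noncomputable def riemannSum {T : ℝ} [Fact (0 < T)] {Ω : Type*} {r : ℕ}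
    (π : TimePartition T) (H W : Time T → Ω → Fin r → ℝ) (t : Time T) (ω : Ω) : ℝ :=
  ∑ i ∈ Finset.range π.n, ∑ j : Fin r,
    H (π.pt i) ω j * (W (min (π.pt (i + 1)) t) ω j - W (min (π.pt i) t) ω j)

/-- `X` is (a version of) the Itô integral `∫ H dW = ∑_j ∫ H^j dW^j` of an adapted
left-continuous integrand `H` with right limits: `X` is adapted and continuous, and the Riemann
sums converge to `X` uniformly on `[0, T]` in probability as the mesh of the partition tends to
`0`. -/
structure IsItoIntegral {T : ℝ} [Fact (0 < T)] {Ω : Type*} {mΩ : MeasurableSpace Ω} {r : ℕ}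
    (𝓕 : Filtration (Time T) mΩ) (P : Measure Ω)
    (H W : Time T → Ω → Fin r → ℝ) (X : Time T → Ω → ℝ) : Prop where
  adapted : StronglyAdapted 𝓕 X
  continuous : ∀ ω, Continuous fun t => X t ω
  ucp : ∀ ε : ℝ, 0 < ε → ∃ ρ : ℝ, 0 < ρ ∧ ∀ π : TimePartition T,
    (∀ i < π.n, ((π.pt (i + 1) : ℝ) - π.pt i) ≤ ρ) →
      P {ω | ∃ t : Time T, ε < |riemannSum π H W t ω - X t ω|} ≤ ENNReal.ofReal ε

/-! ### Point processes -/

/-- A multivariate (`m × m`-variate) adapted point process, through its counting processes: they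
start at `0`, are nondecreasing and right-continuous with jumps of size one, and no two of them
jump at the same time. -/
structure IsPointProcess {T : ℝ} [Fact (0 < T)] {Ω : Type*} {mΩ : MeasurableSpace Ω} {m : ℕ}
    (𝓕 : Filtration (Time T) mΩ) (N : Fin m → Fin m → Time T → Ω → ℕ) : Prop where
  adapted : ∀ k j, Adapted 𝓕 (N k j)
  zero : ∀ k j ω, N k j ⊥ ω = 0
  mono : ∀ k j ω, Monotone fun t => N k j t ω
  rcll : ∀ k j, IsRCLL (N k j)
  unit_jump : ∀ k j ω t, N k j t ω ≤ leftProcess (N k j) t ω + 1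
  no_common_jump : ∀ k j k' j' ω t, (k, j) ≠ (k', j') →
    N k j t ω = leftProcess (N k j) t ω ∨ N k' j' t ω = leftProcess (N k' j') t ω

/-- The pathwise (Lebesgue-Stieltjes) integral `∫_A g_u dn_u` for a counting path `n`, which has
only finitely many jumps on `[0, T]`: the sum of `g` times the jump of `n` over the jump times
in `A`. -/
noncomputable def jumpIntegral {T : ℝ} (g : Time T → ℝ) (n : Time T → ℕ) (A : Set (Time T)) : ℝ :=
  ∑ᶠ u ∈ A, g u * ((n u : ℝ) - ((Function.leftLim n u : ℕ) : ℝ))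

/-! ### The market model -/

/-- Coefficient functions: `Γ`, `Σ` and the intensities `λ^{kj}`. Only their values on
`[0, T] × D` matter. -/
structure Coefficients (d r m : ℕ) where
  Γ : ℝ → EuclideanSpace ℝ (Fin d) → Fin m → Fin d → ℝ
  vol : ℝ → EuclideanSpace ℝ (Fin d) → Fin m → Matrix (Fin d) (Fin r) ℝ
  lam : Fin m → Fin m → ℝ → EuclideanSpace ℝ (Fin d) → ℝ

/-- The market price of risk `Φ = Σᵀ (Σ Σᵀ)⁻¹ Γ`. -/
noncomputable def Coefficients.Φ {d r m : ℕ} (c : Coefficients d r m)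
    (t : ℝ) (x : EuclideanSpace ℝ (Fin d)) (k : Fin m) : Fin r → ℝ :=
  Matrix.mulVec (c.vol t x k).transpose
    (Matrix.mulVec (c.vol t x k * (c.vol t x k).transpose)⁻¹ (c.Γ t x k))

/-- The standing assumptions on the coefficients on `[0, T] × D`: `Γ`, `Σ`, `λ^{kj}` are `C¹`,
`λ^{kj}` is nonnegative and bounded, and `Φ` exists and is bounded. -/
structure Coefficients.Admissible {d r m : ℕ} (c : Coefficients d r m)
    (T : ℝ) (D : Set (EuclideanSpace ℝ (Fin d))) : Prop where
  drift_C1 : ∀ k i, ContDiffOn ℝ 1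
    (fun p : ℝ × EuclideanSpace ℝ (Fin d) => c.Γ p.1 p.2 k i) (Set.Icc 0 T ×ˢ D)
  vol_C1 : ∀ k i j, ContDiffOn ℝ 1
    (fun p : ℝ × EuclideanSpace ℝ (Fin d) => c.vol p.1 p.2 k i j) (Set.Icc 0 T ×ˢ D)
  lam_C1 : ∀ k j, ContDiffOn ℝ 1
    (fun p : ℝ × EuclideanSpace ℝ (Fin d) => c.lam k j p.1 p.2) (Set.Icc 0 T ×ˢ D)
  lam_nonneg : ∀ k j, ∀ t ∈ Set.Icc 0 T, ∀ x ∈ D, 0 ≤ c.lam k j t x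
  lam_bdd : ∃ C : ℝ, ∀ k j, ∀ t ∈ Set.Icc 0 T, ∀ x ∈ D, c.lam k j t x ≤ C
  risk_exists : ∀ k, ∀ t ∈ Set.Icc 0 T, ∀ x ∈ D,
    IsUnit (c.vol t x k * (c.vol t x k).transpose).det
  risk_bdd : ∃ C : ℝ, ∀ k, ∀ t ∈ Set.Icc 0 T, ∀ x ∈ D, ∀ j, |c.Φ t x k j| ≤ C

/-- The random objects of the model: Brownian motion, counting processes, prices, state. The
states `1, …, m` are represented by `Fin m`. -/
structure Processes (T : ℝ) (Ω : Type*) (d r m : ℕ) where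
  W : Time T → Ω → Fin r → ℝ
  N : Fin m → Fin m → Time T → Ω → ℕ
  S : Time T → Ω → EuclideanSpace ℝ (Fin d)
  η : Time T → Ω → Fin m

/-- `(S, η)` solves, with values in `D × {1, …, m}`, the system
`dS_t = Γ(t, S_t, η_{t-}) dt + Σ(t, S_t, η_{t-}) dW_t`,
`dη_t = ∑_{k,j} (j - k) 1_{η_{t-} = k} dN^{kj}_t`,
where `W` is a Brownian motion and `N` is a multivariate point process such that `N^{kj}` has
intensity `λ^{kj}(t, S_t)`, that is, `N^{kj} - ∫ λ^{kj}(t, S_t) dt` is a martingale. -/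
structure IsModel {T : ℝ} [Fact (0 < T)] {Ω : Type*} {mΩ : MeasurableSpace Ω} {d r m : ℕ}
    (D : Set (EuclideanSpace ℝ (Fin d))) (c : Coefficients d r m) (Y : Processes T Ω d r m)
    (𝓕 : Filtration (Time T) mΩ) (P : Measure Ω) : Prop where
  brownian : IsBrownianMotion 𝓕 P Y.W
  point : IsPointProcess 𝓕 Y.N
  S_adapted : StronglyAdapted 𝓕 Y.S
  S_continuous : ∀ ω, Continuous fun t => Y.S t ω
  S_mem : ∀ t ω, Y.S t ω ∈ D
  η_adapted : Adapted 𝓕 Y.η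
  η_rcll : IsRCLL Y.η
  S_eq : ∀ i : Fin d, IsItoIntegral 𝓕 P
    (fun t ω j => c.vol t (Y.S t ω) (leftProcess Y.η t ω) i j) Y.W
    (fun t ω => Y.S t ω i - Y.S ⊥ ω i -
      ∫ u in Set.Iic t, c.Γ u (Y.S u ω) (leftProcess Y.η u ω) i)
  η_eq : ∀ᵐ ω ∂P, ∀ t : Time T, ((Y.η t ω : ℕ) : ℝ) = ((Y.η ⊥ ω : ℕ) : ℝ) +
    ∑ k : Fin m, ∑ j : Fin m, jumpIntegral
      (fun u => (((j : ℕ) : ℝ) - ((k : ℕ) : ℝ)) * (if leftProcess Y.η u ω = k then 1 else 0))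
      (fun u => Y.N k j u ω) (Set.Iic t)
  intensity : ∀ k j, Martingale
    (fun t ω => (Y.N k j t ω : ℝ) - ∫ u in Set.Iic t, c.lam k j u (Y.S u ω)) 𝓕 P

/-- `Q` is the minimal martingale measure, `dQ = Ẑ_T dP` with
`Ẑ = ℰ(X) = exp(X - ½ [X])` for `X = -∫ Φ(t, S_t, η_{t-}) dW_t`, so that
`[X]_T = ∫_0^T |Φ(t, S_t, η_{t-})|² dt`. -/
def IsMinimalMeasure {T : ℝ} [Fact (0 < T)] {Ω : Type*} {mΩ : MeasurableSpace Ω} {d r m : ℕ}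
    (c : Coefficients d r m) (Y : Processes T Ω d r m)
    (𝓕 : Filtration (Time T) mΩ) (P Q : Measure Ω) : Prop :=
  ∃ X : Time T → Ω → ℝ,
    IsItoIntegral 𝓕 P (fun t ω j => -c.Φ t (Y.S t ω) (leftProcess Y.η t ω) j) Y.W X ∧
    Q = P.withDensity fun ω => ENNReal.ofReal (Real.exp (X ⊤ ω -
      1 / 2 * ∫ u : Time T, ∑ j : Fin r, c.Φ u (Y.S u ω) (leftProcess Y.η u ω) j ^ 2))

/-! ### Claims and the recursive equation -/

/-- A payoff triple `(h, δ, f^{kj})`. Only the values for `t ∈ [0, T]`, `x ∈ D` matter. -/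
structure Payoff (d m : ℕ) where
  h : EuclideanSpace ℝ (Fin d) → Fin m → ℝ
  δ : ℝ → EuclideanSpace ℝ (Fin d) → Fin m → ℝ → ℝ
  f : Fin m → Fin m → ℝ → EuclideanSpace ℝ (Fin d) → ℝ → ℝ

/-- `g(t, x, v)` is locally Lipschitz in `v`, uniformly in `(t, x) ∈ [0, T] × D`. -/
def LocLipschitz {d : ℕ} (T : ℝ) (D : Set (EuclideanSpace ℝ (Fin d)))
    (g : ℝ → EuclideanSpace ℝ (Fin d) → ℝ → ℝ) : Prop :=
  ∀ R : ℝ, ∃ L : ℝ, ∀ t ∈ Set.Icc 0 T, ∀ x ∈ D, ∀ v w : ℝ, |v| ≤ R → |w| ≤ R →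
    |g t x v - g t x w| ≤ L * |v - w|

/-- The standing assumptions on payoff triples: continuity of all functions, boundedness of `h`,
linear growth in `v` of `δ` and `f^{kj}`, which are `C¹` in `(t, x, v)` and locally Lipschitz in
`v`, uniformly in `(t, x)`. -/
structure Payoff.Admissible {d m : ℕ} (p : Payoff d m)
    (T : ℝ) (D : Set (EuclideanSpace ℝ (Fin d))) : Prop where
  h_cont : ∀ k, ContinuousOn (fun x => p.h x k) D
  h_bdd : ∃ C : ℝ, ∀ k, ∀ x ∈ D, |p.h x k| ≤ C
  growth : ∃ K : ℝ, ∀ t ∈ Set.Icc 0 T, ∀ x ∈ D, ∀ v : ℝ,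
    (∀ k, |p.δ t x k v| ≤ K * (1 + |v|)) ∧ ∀ k j, |p.f k j t x v| ≤ K * (1 + |v|)
  δ_C1 : ∀ k, ContDiffOn ℝ 1
    (fun q : ℝ × EuclideanSpace ℝ (Fin d) × ℝ => p.δ q.1 q.2.1 k q.2.2)
    (Set.Icc 0 T ×ˢ D ×ˢ Set.univ)
  f_C1 : ∀ k j, ContDiffOn ℝ 1
    (fun q : ℝ × EuclideanSpace ℝ (Fin d) × ℝ => p.f k j q.1 q.2.1 q.2.2)
    (Set.Icc 0 T ×ˢ D ×ˢ Set.univ)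
  δ_lip : ∀ k, LocLipschitz T D fun t x v => p.δ t x k v
  f_lip : ∀ k j, LocLipschitz T D (p.f k j)

/-- The payments during `(t, T]` (including the final one) when the value process is `V`:
`h(S_T, η_T) + ∫_t^T δ(u, S_u, η_{u-}, V_{u-}) du
  + ∫_t^T ∑_{k ≠ j} f^{kj}(u, S_u, V_{u-}) 1_{η_{u-} = k} dN^{kj}_u`. -/
noncomputable def futurePayments {T : ℝ} [Fact (0 < T)] {Ω : Type*} {d r m : ℕ}
    (Y : Processes T Ω d r m) (p : Payoff d m) (V : Time T → Ω → ℝ) (t : Time T) (ω : Ω) : ℝ :=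
  p.h (Y.S ⊤ ω) (Y.η ⊤ ω) +
    (∫ u in Set.Ioi t, p.δ u (Y.S u ω) (leftProcess Y.η u ω) (leftProcess V u ω)) +
    ∑ k : Fin m, ∑ j ∈ Finset.univ.filter (fun j : Fin m => j ≠ k), jumpIntegral
      (fun u => p.f k j u (Y.S u ω) (leftProcess V u ω) *
        (if leftProcess Y.η u ω = k then 1 else 0))
      (fun u => Y.N k j u ω) (Set.Ioi t)

/-- The recursive equation `V_t = E_Q[payments during (t, T] | 𝓕_t]`, `t ∈ [0, T]`. -/
def SolvesRecursion {T : ℝ} [Fact (0 < T)] {Ω : Type*} {mΩ : MeasurableSpace Ω} {d r m : ℕ}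
    (Y : Processes T Ω d r m) (p : Payoff d m)
    (𝓕 : Filtration (Time T) mΩ) (Q : Measure Ω) (V : Time T → Ω → ℝ) : Prop :=
  ∀ t : Time T, V t =ᵐ[Q] Q[futurePayments Y p V t | 𝓕 t]

end RecursiveClaim

/-!
The difference `U = V₁ - V₂` of two solutions is estimated in `L²(P)`, with `P` used as the
reference measure for both choices of `Q`.

* Given bounded processes `V₁`, `V₂`, the payment rates differ by at most `L |U_{u-}|`, because
  `δ` and `f^{kj}` are locally Lipschitz in `v`. The future payments are pathwise limits of Riemann
  sums along uniform grids (`tendsto_paymentSum`). On a fine grid at most one jump falls into each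
  cell, so increments of `N` may be truncated at one. The truncated increments are bounded and,
  as the intensities are bounded, have conditional mean `O(T / (n + 1))`; a discrete Gronwall
  estimate (`lintegral_sq_sum_le`) and Fatou's lemma then bound the second moment of the
  difference of the future payments by a constant times `∫_t^T E_P |U_{u-}|² du`, which is stated
  for exponential bounds on `E_P |U_{u-}|²` (`exists_lintegral_sq_futurePayments_sub_le`).
* `U_t` is the `Q`-conditional expectation of that difference. Under the minimal measure
  `dQ = Z dP`, boundedness of `Φ` gives exponential moments of the Itô integral in the density,
  conditionally on `𝓕 t`, from the Gaussian moment generating function along Riemann sums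
  (`IsItoIntegral.lintegral_mul_exp_le`). Hence `Z = E R` with `E` `𝓕 t`-measurable and with `R²`
  and `R⁻¹` conditionally bounded in mean, and conditional expectation under `Q` is bounded in
  `L²(P)` (`lintegral_sq_condExp_withDensity_le`). In particular the intensity of `N` under `Q` is
  never needed.
* Together, `E_P |U_t|² ≤ c ∫_t^T E_P |U_{u-}|² du`. If `E_P |U_{s-}|² ≤ B e^{-βs}` for all `s` with
  `β > 2c`, the same holds with `B / 2` for `U_s`, and by Fatou's lemma for `U_{s-}` again.
  Iterating, `U_t = 0` almost surely for each `t`, and right-continuity removes the dependence of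
  the null set on `t`.
-/

open MeasureTheory ProbabilityTheory Filter Topology

namespace RecursiveClaim

/-! ### Uniform grids and left-continuous paths -/

/-- The point `i T / (n + 1)` of the uniform grid with `n + 1` cells, clipped to `[0, T]`. -/
noncomputable def grid {T : ℝ} [Fact (0 < T)] (n i : ℕ) : Time T :=
  Set.projIcc 0 T (Fact.out : (0 : ℝ) < T).le (i * T / (n + 1))

section Time

variable {T : ℝ}

/-- Left-continuity at every time. -/
def LeftCts {E : Type*} [TopologicalSpace E] (g : Time T → E) : Prop :=
  ∀ u, Tendsto g (𝓝[<] u) (𝓝 (g u))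

lemma _root_.Continuous.leftCts {E : Type*} [TopologicalSpace E] {g : Time T → E}
    (hg : Continuous g) : LeftCts g := fun u => (hg.tendsto u).mono_left nhdsWithin_le_nhds

lemma volume_Ioc_time (a b : Time T) :
    (volume : Measure (Time T)) (Set.Ioc a b) = ENNReal.ofReal ((b : ℝ) - a) := by
  rw [← volume_image_subtype_coe measurableSet_Icc, ← Real.volume_Ioc]
  congr 1
  ext x
  simp only [Set.mem_image, Set.mem_Ioc, Subtype.exists, exists_and_right, exists_eq_right]
  constructor
  · rintro ⟨hx, h1, h2⟩; exact ⟨h1, h2⟩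
  · rintro ⟨h1, h2⟩; exact ⟨⟨a.2.1.trans h1.le, h2.trans b.2.2⟩, h1, h2⟩

lemma IsRCLL.leftCts {Ω E : Type*} [TopologicalSpace E] [T3Space E] {X : Time T → Ω → E}
    (hX : IsRCLL X) (ω : Ω) : LeftCts fun u => leftProcess X u ω := by
  intro u
  have h := continuousWithinAt_leftLim_Iic (f := fun s => X s ω) (a := u)
    (tendsto_leftLim_of_tendsto (hX ω u).2)
  exact h.mono_left (nhdsWithin_mono _ Set.Iio_subset_Iic_self)

lemma leftCts_indicator_Ioi (t : Time T) : LeftCts (Set.indicator (Set.Ioi t) (1 : Time T → ℝ)) := by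
  intro u
  by_cases h : t < u
  · rw [Set.indicator_of_mem (show u ∈ Set.Ioi t from h)]
    refine tendsto_const_nhds.congr' ?_
    filter_upwards [mem_nhdsWithin_of_mem_nhds (Ioi_mem_nhds h)] with s hs
    rw [Set.indicator_of_mem hs, Pi.one_apply, Pi.one_apply]
  · rw [Set.indicator_of_notMem (show u ∉ Set.Ioi t from h)]
    refine tendsto_const_nhds.congr' ?_
    filter_upwards [self_mem_nhdsWithin] with s hs
    rw [Set.indicator_of_notMem]
    exact fun h' => h (lt_trans h' hs)

instance : IsFiniteMeasure (volume : Measure (Time T)) :=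
  ⟨by rw [Measure.Subtype.volume_univ measurableSet_Icc.nullMeasurableSet]; simp⟩

end Time

section Grid

variable {T : ℝ} [hT : Fact (0 < T)]

lemma grid_coe {n i : ℕ} (hi : i ≤ n + 1) : ((grid n i : Time T) : ℝ) = i * T / (n + 1) := by
  have h0 := hT.out
  have h1 : (i : ℝ) ≤ n + 1 := by exact_mod_cast hi
  rw [grid, Set.projIcc_of_mem]
  refine ⟨by positivity, ?_⟩
  rw [div_le_iff₀ (by positivity)]
  nlinarith

lemma grid_mono (n : ℕ) : Monotone (grid n : ℕ → Time T) := by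
  intro i j hij
  apply Set.monotone_projIcc
  have h0 := hT.out
  have : (i : ℝ) ≤ j := by exact_mod_cast hij
  gcongr

lemma grid_zero (n : ℕ) : (grid n 0 : Time T) = ⊥ := by
  apply Subtype.ext
  rw [grid_coe (by omega)]
  simp [Set.Icc.coe_bot]

lemma grid_last (n : ℕ) : (grid n (n + 1) : Time T) = ⊤ := by
  apply Subtype.ext
  rw [grid_coe le_rfl]
  have : (n : ℝ) + 1 ≠ 0 := by positivity
  push_cast
  field_simp

lemma grid_step {n i : ℕ} (hi : i < n + 1) :
    ((grid n (i + 1) : Time T) : ℝ) - (grid n i : Time T) = T / (n + 1) := by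
  rw [grid_coe (by omega), grid_coe (by omega)]
  push_cast
  ring

/-- The uniform grid as a partition. -/
noncomputable def gridPartition (T : ℝ) [Fact (0 < T)] (n : ℕ) : TimePartition T where
  n := n + 1
  pt := grid n
  mono := grid_mono n
  first := grid_zero n
  last := grid_last n

/-- The index `i` of the cell `(t_i, t_{i+1}]` of the grid that contains `u > 0`. -/
noncomputable def cellIdx (n : ℕ) (u : Time T) : ℕ := ⌈(u : ℝ) * (n + 1) / T⌉₊ - 1

lemma mem_cell_iff {n i : ℕ} {u : Time T} (hu : ⊥ < u) (hi : i < n + 1) :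
    u ∈ Set.Ioc (grid n i) (grid n (i + 1)) ↔ i = cellIdx n u := by
  have h0 := hT.out
  have hu' : (0 : ℝ) < u := by simpa using (show ((⊥ : Time T) : ℝ) < u from hu)
  have hpos : 0 < (u : ℝ) * (n + 1) / T := by positivity
  have hc : 0 < ⌈(u : ℝ) * (n + 1) / T⌉₊ := Nat.ceil_pos.2 hpos
  have key : ⌈(u : ℝ) * (n + 1) / T⌉₊ = i + 1 ↔ i = cellIdx n u := by
    unfold cellIdx; omega
  rw [← key, Nat.ceil_eq_iff (by omega), Set.mem_Ioc, ← Subtype.coe_lt_coe, ← Subtype.coe_le_coe,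
    grid_coe (by omega), grid_coe (by omega), div_lt_iff₀ (by positivity),
    le_div_iff₀ (by positivity), lt_div_iff₀ h0, div_le_iff₀ h0]
  simp

lemma cellIdx_lt (n : ℕ) (u : Time T) : cellIdx n u < n + 1 := by
  have h0 := hT.out
  have : ⌈(u : ℝ) * (n + 1) / T⌉₊ ≤ n + 1 := by
    rw [Nat.ceil_le, div_le_iff₀ h0]
    push_cast
    have := u.2.2
    nlinarith
  unfold cellIdx; omega

lemma mem_cell {n : ℕ} {u : Time T} (hu : ⊥ < u) :
    u ∈ Set.Ioc (grid n (cellIdx n u)) (grid n (cellIdx n u + 1)) :=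
  (mem_cell_iff hu (cellIdx_lt n u)).2 rfl

lemma tendsto_mesh (T : ℝ) : Tendsto (fun n : ℕ => T / ((n : ℝ) + 1)) atTop (𝓝 0) :=
  tendsto_const_nhds.div_atTop
    (tendsto_atTop_add_const_right _ _ tendsto_natCast_atTop_atTop)

lemma tendsto_grid_cellIdx {u : Time T} (hu : ⊥ < u) :
    Tendsto (fun n => (grid n (cellIdx n u) : Time T)) atTop (𝓝[<] u) := by
  refine tendsto_nhdsWithin_iff.2 ⟨?_, Eventually.of_forall fun n => (mem_cell hu).1⟩
  rw [tendsto_subtype_rng]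
  have h1 : Tendsto (fun n : ℕ => (u : ℝ) - T / ((n : ℝ) + 1)) atTop (𝓝 u) := by
    simpa using tendsto_const_nhds.sub (tendsto_mesh T)
  refine tendsto_of_tendsto_of_tendsto_of_le_of_le h1 tendsto_const_nhds (fun n => ?_)
    fun n => (mem_cell hu).1.le
  have h2 := grid_step (T := T) (cellIdx_lt n u)
  have h3 : (u : ℝ) ≤ (grid n (cellIdx n u + 1) : Time T) := (mem_cell (n := n) hu).2
  simp only; linarith

lemma ae_bot_lt : ∀ᵐ u : Time T, ⊥ < u := by
  have h : (volume : Measure (Time T)) {⊥} = 0 := by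
    rw [← volume_image_subtype_coe measurableSet_Icc]; simp
  filter_upwards [measure_eq_zero_iff_ae_notMem.1 h] with u hu
  exact bot_lt_iff_ne_bot.2 hu

lemma time_volume_real_Iic_le (t : Time T) : (volume : Measure (Time T)).real (Set.Iic t) ≤ T := by
  have h1 : (volume : Measure (Time T)) Set.univ = ENNReal.ofReal T := by
    rw [Measure.Subtype.volume_univ measurableSet_Icc.nullMeasurableSet]; simp
  have h2 : (volume : Measure (Time T)).real Set.univ = T := by
    rw [measureReal_def, h1, ENNReal.toReal_ofReal hT.out.le]
  exact (measureReal_mono (Set.subset_univ _)).trans h2.le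

lemma sum_cell_indicator {u : Time T} (hu : ⊥ < u) (n : ℕ) (a : ℕ → ℝ) :
    ∑ i ∈ Finset.range (n + 1), (Set.Ioc (grid n i) (grid n (i + 1))).indicator (fun _ => a i) u
      = a (cellIdx n u) := by
  rw [Finset.sum_eq_single (cellIdx n u)]
  · exact Set.indicator_of_mem (mem_cell hu) _
  · intro i hi hne
    refine Set.indicator_of_notMem (fun h => hne ?_) _
    exact (mem_cell_iff hu (Finset.mem_range.1 hi)).1 h
  · intro h; exact absurd (Finset.mem_range.2 (cellIdx_lt n u)) h

/-- Riemann sums of a bounded left-continuous function converge to its integral. -/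
lemma LeftCts.integrable_and_tendsto {g : Time T → ℝ} (hg : LeftCts g) {C : ℝ}
    (hC : ∀ u, |g u| ≤ C) :
    Integrable g ∧
    Tendsto (fun n => ∑ i ∈ Finset.range (n + 1), g (grid n i) * (T / (n + 1))) atTop
      (𝓝 (∫ u, g u)) := by
  set G : ℕ → Time T → ℝ := fun n u => ∑ i ∈ Finset.range (n + 1),
    (Set.Ioc (grid n i) (grid n (i + 1))).indicator (fun _ => g (grid n i)) u with hG
  have hGm : ∀ n, Measurable (G n) := fun n =>
    Finset.measurable_sum _ fun i _ => measurable_const.indicator measurableSet_Ioc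
  have hlim : ∀ᵐ u : Time T, Tendsto (fun n => G n u) atTop (𝓝 (g u)) := by
    filter_upwards [ae_bot_lt] with u hu
    have : (fun n => G n u) = fun n => g (grid n (cellIdx n u)) := by
      ext n; exact sum_cell_indicator hu n fun i => g (grid n i)
    rw [this]
    exact (hg u).comp (tendsto_grid_cellIdx hu)
  have hgm : AEStronglyMeasurable g volume :=
    aestronglyMeasurable_of_tendsto_ae _ (fun n => (hGm n).aestronglyMeasurable) hlim
  refine ⟨.of_bound hgm C (Eventually.of_forall hC), ?_⟩
  have hint : ∀ n, ∫ u, G n u = ∑ i ∈ Finset.range (n + 1), g (grid n i) * (T / (n + 1)) := by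
    intro n
    rw [integral_finsetSum]
    · refine Finset.sum_congr rfl fun i hi => ?_
      have h2 := grid_step (T := T) (Finset.mem_range.1 hi)
      have h0 := hT.out
      rw [integral_indicator_const _ measurableSet_Ioc, measureReal_def, volume_Ioc_time, h2,
        ENNReal.toReal_ofReal (by positivity), smul_eq_mul, mul_comm]
    · intro i _
      exact (integrable_const _).indicator measurableSet_Ioc
  simp_rw [← hint]
  refine tendsto_integral_of_dominated_convergence (fun _ => C)
    (fun n => (hGm n).aestronglyMeasurable) (integrable_const _) (fun n => ?_) hlim
  filter_upwards [ae_bot_lt] with u hu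
  rw [hG]
  simp only
  rw [sum_cell_indicator hu n fun i => g (grid n i)]
  exact hC _

/-! ### Counting paths -/

lemma const_of_no_jump {n : Time T → ℕ} (hm : Monotone n)
    (hr : ∀ t, ContinuousWithinAt n (Set.Ici t) t) {a b : Time T} (hab : a ≤ b)
    (hj : ∀ u ∈ Set.Ioc a b, n u = Function.leftLim n u) : n a = n b := by
  have hcont : ContinuousOn n (Set.Icc a b) := by
    intro x hx
    rcases hx.1.eq_or_lt with rfl | hax
    · exact (hr a).mono Set.Icc_subset_Ici_self
    · have hl : ContinuousWithinAt n (Set.Iio x) x := by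
        have := hm.tendsto_leftLim x
        rwa [← hj x ⟨hax, hx.2⟩] at this
      refine ContinuousAt.continuousWithinAt ?_
      have := hl.union (hr x)
      rw [Set.Iio_union_Ici] at this
      exact this.continuousAt univ_mem
  exact isPreconnected_Icc.constant hcont (Set.left_mem_Icc.2 hab) (Set.right_mem_Icc.2 hab)

/-- The jump times of a path. -/
def jumpTimes (n : Time T → ℕ) : Set (Time T) := {u | n u ≠ Function.leftLim n u}

lemma jumpTimes_finite {n : Time T → ℕ} (hm : Monotone n) : (jumpTimes n).Finite := by
  have hlt : ∀ u ∈ jumpTimes n, Function.leftLim n u < n u := fun u hu =>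
    lt_of_le_of_ne (hm.leftLim_le le_rfl) (Ne.symm hu)
  refine Set.Finite.of_injOn (f := n) (t := Set.Iic (n ⊤)) (fun u _ => hm le_top) ?_
    (Set.finite_Iic _)
  intro u hu v hv huv
  rcases lt_trichotomy u v with h | h | h
  · have := hm.le_leftLim h; have := hlt v hv; omega
  · exact h
  · have := hm.le_leftLim h; have := hlt u hu; omega

lemma bot_lt_of_mem_jumpTimes {n : Time T → ℕ} {u : Time T} (hu : u ∈ jumpTimes n) : ⊥ < u := by
  rw [bot_lt_iff_ne_bot]
  rintro rfl
  exact hu (leftLim_eq_of_isBot isBot_bot).symm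

/-- On a grid that is fine enough to separate the jump times, each increment truncated at one
counts the at most one jump in its cell. -/
lemma tendsto_jumpIntegral {n : Time T → ℕ} (hm : Monotone n)
    (hr : ∀ t, ContinuousWithinAt n (Set.Ici t) t) (hu : ∀ t, n t ≤ Function.leftLim n t + 1)
    {g : Time T → ℝ} (hg : LeftCts g) :
    Tendsto (fun N => ∑ i ∈ Finset.range (N + 1),
      g (grid N i) * ((min (n (grid N (i + 1)) - n (grid N i)) 1 : ℕ) : ℝ)) atTop
      (𝓝 (jumpIntegral g n Set.univ)) := by
  set J := (jumpTimes_finite hm).toFinset with hJ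
  have hmem : ∀ u, u ∈ J ↔ n u ≠ Function.leftLim n u := fun u => by simp [hJ, jumpTimes]
  have hbot : ∀ u ∈ J, ⊥ < u := fun u hu => bot_lt_of_mem_jumpTimes ((hmem u).1 hu)
  have hlt : ∀ u ∈ J, Function.leftLim n u < n u := fun u hu =>
    lt_of_le_of_ne (hm.leftLim_le le_rfl) (Ne.symm ((hmem u).1 hu))
  have hint : jumpIntegral g n Set.univ = ∑ u ∈ J, g u := by
    unfold jumpIntegral
    rw [finsum_mem_univ, finsum_eq_sum_of_support_subset (s := J)]
    · refine Finset.sum_congr rfl fun u h => ?_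
      have h1 := hlt u h
      have h2 : n u = Function.leftLim n u + 1 := le_antisymm (hu u) h1
      rw [h2]; push_cast; ring
    · intro u h
      rw [Finset.mem_coe, hmem]
      intro h'
      rw [Function.mem_support, h'] at h
      simp at h
  have hsep : ∀ᶠ N : ℕ in atTop, Set.InjOn (cellIdx N) (J : Set (Time T)) := by
    have : ∀ u ∈ J, ∀ v ∈ J, ∀ᶠ N : ℕ in atTop, cellIdx N u = cellIdx N v → u = v := by
      intro u hu v hv
      by_cases huv : u = v
      · exact Eventually.of_forall fun _ _ => huv
      wlog h : u < v generalizing u v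
      · have := this v hv u hu (Ne.symm huv) (lt_of_le_of_ne (not_lt.1 h) (Ne.symm huv))
        filter_upwards [this] with N hN h'
        exact (hN h'.symm).symm
      · have h1 := (tendsto_nhdsWithin_iff.1 (tendsto_grid_cellIdx (hbot v hv))).1
        filter_upwards [h1.eventually (lt_mem_nhds h)] with N hN h'
        have h2 := (mem_cell (n := N) (hbot u hu))
        have h3 := (mem_cell (n := N) (hbot v hv))
        rw [h'] at h2
        exact absurd h2.1 (not_lt.2 hN.le)
    have h2 : ∀ᶠ N : ℕ in atTop, ∀ u ∈ J, ∀ v ∈ J, cellIdx N u = cellIdx N v → u = v := by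
      rw [Filter.eventually_all_finset]
      intro u hu
      rw [Filter.eventually_all_finset]
      exact this u hu
    filter_upwards [h2] with N hN u hu v hv h
    exact hN u hu v hv h
  rw [hint]
  have hlim : Tendsto (fun N => ∑ u ∈ J, g (grid N (cellIdx N u))) atTop (𝓝 (∑ u ∈ J, g u)) :=
    tendsto_finsetSum _ fun u h => (hg u).comp (tendsto_grid_cellIdx (hbot u h))
  refine hlim.congr' ?_
  filter_upwards [hsep] with N hN
  rw [← Finset.sum_image (f := fun i => g (grid N i)) hN]
  have hsub : J.image (cellIdx N) ⊆ Finset.range (N + 1) := by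
    intro i hi
    obtain ⟨u, _, rfl⟩ := Finset.mem_image.1 hi
    exact Finset.mem_range.2 (cellIdx_lt N u)
  rw [← Finset.sum_subset hsub (f := fun i =>
      g (grid N i) * ((min (n (grid N (i + 1)) - n (grid N i)) 1 : ℕ) : ℝ))]
  · refine Finset.sum_congr rfl fun i hi => ?_
    obtain ⟨u, hu', rfl⟩ := Finset.mem_image.1 hi
    have h1 := mem_cell (n := N) (hbot u hu')
    have h2 := hm.le_leftLim h1.1
    have h3 := hm h1.2
    have h4 := hlt u hu'
    rw [Nat.min_eq_right (by omega)]; simp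
  · intro i hi hni
    rw [const_of_no_jump hm hr (grid_mono N (Nat.le_succ i))]
    · simp
    · intro u hu'
      by_contra h
      have hJu := (hmem u).2 h
      refine hni (Finset.mem_image.2 ⟨u, hJu, ?_⟩)
      exact ((mem_cell_iff (hbot u hJu) (Finset.mem_range.1 hi)).1 hu').symm

end Grid

/-! ### Moments of sums driven by counting processes -/

open scoped ENNReal in
lemma lintegral_le_of_tendsto {Ω : Type*} {mΩ : MeasurableSpace Ω} {P : Measure Ω}
    {f : ℕ → Ω → ℝ≥0∞} {g : Ω → ℝ≥0∞} (hf : ∀ n, Measurable (f n))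
    (hfg : ∀ᵐ ω ∂P, Tendsto (fun n => f n ω) atTop (𝓝 (g ω))) {c : ℕ → ℝ≥0∞} {c' : ℝ≥0∞}
    (hc : ∀ n, ∫⁻ ω, f n ω ∂P ≤ c n) (hcc : Tendsto c atTop (𝓝 c')) : ∫⁻ ω, g ω ∂P ≤ c' := by
  calc ∫⁻ ω, g ω ∂P = ∫⁻ ω, liminf (fun n => f n ω) atTop ∂P :=
        lintegral_congr_ae (hfg.mono fun ω hω => hω.liminf_eq.symm)
    _ ≤ liminf (fun n => ∫⁻ ω, f n ω ∂P) atTop := lintegral_liminf_le hf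
    _ ≤ liminf c atTop := liminf_le_liminf (Eventually.of_forall hc)
    _ = c' := hcc.liminf_eq

open scoped ENNReal in
/-- A bound on `E[D; A]` for `A` in a sub-σ-algebra extends from indicators of `A` to
nonnegative weights. -/
lemma lintegral_mul_le_of_setLIntegral_le {Ω : Type*} {m mΩ : MeasurableSpace Ω} (hm : m ≤ mΩ)
    {P : Measure Ω} {D : Ω → ℝ≥0∞} (hD : Measurable D) {c : ℝ≥0∞}
    (h : ∀ A, MeasurableSet[m] A → ∫⁻ ω in A, D ω ∂P ≤ c * P A)
    {ζ : Ω → ℝ≥0∞} (hζ : Measurable[m] ζ) :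
    ∫⁻ ω, ζ ω * D ω ∂P ≤ c * ∫⁻ ω, ζ ω ∂P := by
  have h1 : (P.withDensity D).trim hm ≤ (c • P).trim hm := by
    refine Measure.le_iff.2 fun A hA => ?_
    rw [trim_measurableSet_eq hm hA, trim_measurableSet_eq hm hA, withDensity_apply _ (hm _ hA),
      Measure.smul_apply, smul_eq_mul]
    exact h A hA
  calc ∫⁻ ω, ζ ω * D ω ∂P = ∫⁻ ω, ζ ω ∂(P.withDensity D) := by
        rw [lintegral_withDensity_eq_lintegral_mul _ hD (hζ.mono hm le_rfl)]
        simp only [Pi.mul_apply, mul_comm]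
    _ = ∫⁻ ω, ζ ω ∂((P.withDensity D).trim hm) := (lintegral_trim hm hζ).symm
    _ ≤ ∫⁻ ω, ζ ω ∂((c • P).trim hm) := lintegral_mono' h1 le_rfl
    _ = c * ∫⁻ ω, ζ ω ∂P := by
        rw [lintegral_trim hm hζ, lintegral_smul_measure, smul_eq_mul]

open scoped ENNReal in
/-- One step of a discrete Gronwall argument, iterated: sums `∑ H_i ξ_i` with predictable
`H_i` and increments `ξ_i ≤ B` of conditional mean at most `κ`. The cross term is handled by
`2 I H ≤ I² + H²`. -/
lemma lintegral_sq_sum_le {Ω : Type*} {mΩ : MeasurableSpace Ω} {P : Measure Ω}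
    (m : ℕ → MeasurableSpace Ω) (hmono : Monotone m) (hm : ∀ i, m i ≤ mΩ)
    {H ξ : ℕ → Ω → ℝ≥0∞} (n : ℕ) (hH : ∀ i < n, Measurable[m i] (H i))
    (hξ : ∀ i < n, Measurable[m (i + 1)] (ξ i)) {κ B : ℝ≥0∞} (hB : ∀ i < n, ∀ ω, ξ i ω ≤ B)
    (hκ : ∀ i < n, ∀ ζ : Ω → ℝ≥0∞, Measurable[m i] ζ →
      ∫⁻ ω, ζ ω * ξ i ω ∂P ≤ κ * ∫⁻ ω, ζ ω ∂P) :
    ∫⁻ ω, (∑ i ∈ Finset.range n, H i ω * ξ i ω) ^ 2 ∂P ≤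
      (1 + κ) ^ n * ∑ i ∈ Finset.range n, (1 + B) * κ * ∫⁻ ω, H i ω ^ 2 ∂P := by
  have key : ∀ k ≤ n, (Measurable[m k] fun ω => ∑ i ∈ Finset.range k, H i ω * ξ i ω) ∧
      ∫⁻ ω, (∑ i ∈ Finset.range k, H i ω * ξ i ω) ^ 2 ∂P ≤
      (1 + κ) ^ k * ∑ i ∈ Finset.range k, (1 + B) * κ * ∫⁻ ω, H i ω ^ 2 ∂P := by
    intro k
    induction k with
    | zero => intro _; simp
    | succ k ih =>
      intro hk
      obtain ⟨ihm, ihb⟩ := ih (by omega)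
      have hHk := hH k (by omega)
      have hξk := hξ k (by omega)
      constructor
      · simp_rw [Finset.sum_range_succ]
        exact (ihm.mono (hmono k.le_succ) le_rfl).add
          ((hHk.mono (hmono k.le_succ) le_rfl).mul hξk)
      set I : Ω → ℝ≥0∞ := fun ω => ∑ i ∈ Finset.range k, H i ω * ξ i ω with hI
      have hIm : Measurable I := ihm.mono (hm _) le_rfl
      have hHm : Measurable (H k) := hHk.mono (hm _) le_rfl
      have hξm : Measurable (ξ k) := hξk.mono (hm _) le_rfl
      have h1 : ∀ ω, (∑ i ∈ Finset.range (k + 1), H i ω * ξ i ω) ^ 2 ≤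
          I ω ^ 2 + (I ω ^ 2 + (1 + B) * H k ω ^ 2) * ξ k ω := by
        intro ω
        have h2 : 2 * (I ω * H k ω) ≤ I ω ^ 2 + H k ω ^ 2 := by
          by_cases hi : I ω = ∞
          · simp [hi]
          by_cases hh : H k ω = ∞
          · simp [hh]
          lift I ω to NNReal using hi with a
          lift H k ω to NNReal using hh with b
          norm_cast
          rw [← mul_assoc]
          exact two_mul_le_add_sq a b
        have h3 : ξ k ω * ξ k ω ≤ B * ξ k ω := by gcongr; exact hB k (by omega) ω
        rw [Finset.sum_range_succ]
        change (I ω + H k ω * ξ k ω) ^ 2 ≤ _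
        calc (I ω + H k ω * ξ k ω) ^ 2
            = I ω ^ 2 + 2 * (I ω * H k ω) * ξ k ω + H k ω ^ 2 * (ξ k ω * ξ k ω) := by ring
          _ ≤ I ω ^ 2 + (I ω ^ 2 + H k ω ^ 2) * ξ k ω + H k ω ^ 2 * (B * ξ k ω) := by gcongr
          _ = I ω ^ 2 + (I ω ^ 2 + (1 + B) * H k ω ^ 2) * ξ k ω := by ring
      calc ∫⁻ ω, (∑ i ∈ Finset.range (k + 1), H i ω * ξ i ω) ^ 2 ∂P
          ≤ ∫⁻ ω, I ω ^ 2 + (I ω ^ 2 + (1 + B) * H k ω ^ 2) * ξ k ω ∂P := lintegral_mono h1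
        _ = ∫⁻ ω, I ω ^ 2 ∂P + ∫⁻ ω, (I ω ^ 2 + (1 + B) * H k ω ^ 2) * ξ k ω ∂P :=
            lintegral_add_left (hIm.pow_const 2) _
        _ ≤ ∫⁻ ω, I ω ^ 2 ∂P + κ * ∫⁻ ω, I ω ^ 2 + (1 + B) * H k ω ^ 2 ∂P := by
            gcongr
            exact hκ k (by omega) _ ((ihm.pow_const 2).add ((hHk.pow_const 2).const_mul _))
        _ = ∫⁻ ω, I ω ^ 2 ∂P + κ * (∫⁻ ω, I ω ^ 2 ∂P + (1 + B) * ∫⁻ ω, H k ω ^ 2 ∂P) := by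
            rw [lintegral_add_left (hIm.pow_const 2), lintegral_const_mul _ (hHm.pow_const 2)]
        _ = (1 + κ) * ∫⁻ ω, I ω ^ 2 ∂P + 1 * ((1 + B) * κ * ∫⁻ ω, H k ω ^ 2 ∂P) := by ring
        _ ≤ (1 + κ) * ((1 + κ) ^ k * ∑ i ∈ Finset.range k, (1 + B) * κ * ∫⁻ ω, H i ω ^ 2 ∂P)
            + (1 + κ) ^ (k + 1) * ((1 + B) * κ * ∫⁻ ω, H k ω ^ 2 ∂P) := by
            gcongr
            exact one_le_pow₀ (by simp)
        _ = (1 + κ) ^ (k + 1) *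
            ∑ i ∈ Finset.range (k + 1), (1 + B) * κ * ∫⁻ ω, H i ω ^ 2 ∂P := by
            rw [Finset.sum_range_succ]; ring
  exact (key n le_rfl).2

section Counting

variable {T : ℝ} [Fact (0 < T)] {Ω : Type*} {mΩ : MeasurableSpace Ω}
  {𝓕 : Filtration (Time T) mΩ} {P : Measure Ω} [IsProbabilityMeasure P]

/-- The conditional mean of an increment of a counting process with intensity at most `C`. -/
lemma setLIntegral_increment_le {n : Time T → Ω → ℕ} (hn : Adapted 𝓕 n)
    (hmono : ∀ ω, Monotone fun t => n t ω) {l : Time T → Ω → ℝ} {C : ℝ}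
    (hl : ∀ ω, Continuous fun t => l t ω) (hl0 : ∀ t ω, 0 ≤ l t ω) (hlC : ∀ t ω, l t ω ≤ C)
    (hmart : Martingale (fun t ω => (n t ω : ℝ) - ∫ u in Set.Iic t, l u ω) 𝓕 P)
    {s t : Time T} (hst : s ≤ t) {A : Set Ω} (hA : MeasurableSet[𝓕 s] A) :
    ∫⁻ ω in A, ((n t ω - n s ω : ℕ) : ENNReal) ∂P ≤
      ENNReal.ofReal (C * ((t : ℝ) - s)) * P A := by
  have hne : Nonempty Ω := nonempty_of_isProbabilityMeasure P
  have hC : 0 ≤ C := (hl0 s hne.some).trans (hlC s _)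
  have hst' : (s : ℝ) ≤ t := hst
  set Λ : Time T → Ω → ℝ := fun t ω => ∫ u in Set.Iic t, l u ω with hΛ
  have hli : ∀ ω, Integrable fun u => l u ω := fun ω =>
    ((hl ω).leftCts.integrable_and_tendsto (C := C)
      fun u => by rw [abs_of_nonneg (hl0 u ω)]; exact hlC u ω).1
  have hnm : ∀ t, Measurable fun ω => (n t ω : ℝ) := fun t =>
    (measurable_from_top.comp ((hn t).mono (𝓕.le t) le_rfl))
  have hΛm : ∀ t, AEStronglyMeasurable (Λ t) P := fun t => by
    have h1 := ((hmart.1 t).mono (𝓕.le t)).measurable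
    have : Λ t = fun ω => (n t ω : ℝ) - ((n t ω : ℝ) - Λ t ω) := by ext; ring
    rw [this]
    exact ((hnm t).sub h1).aestronglyMeasurable
  have hΛb : ∀ t ω, |Λ t ω| ≤ C * T := fun t ω => by
    refine (norm_setIntegral_le_of_norm_le_const (C := C) (measure_lt_top (volume : Measure (Time T)) _)
      (fun u _ => by rw [Real.norm_eq_abs, abs_of_nonneg (hl0 u ω)]; exact hlC u ω)).trans ?_
    exact mul_le_mul_of_nonneg_left (time_volume_real_Iic_le t) hC
  have hΛi : ∀ t, Integrable (Λ t) P := fun t =>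
    .of_bound (hΛm t) _ (Eventually.of_forall (hΛb t))
  have hni : ∀ t, Integrable (fun ω => (n t ω : ℝ)) P := fun t => by
    have := (hmart.integrable t).add (hΛi t)
    refine this.congr (Eventually.of_forall fun ω => ?_)
    simp [hΛ]
  have hinc : ∀ ω, Λ t ω - Λ s ω ≤ C * ((t : ℝ) - s) := fun ω => by
    have h1 : Λ t ω = Λ s ω + ∫ u in Set.Ioc s t, l u ω := by
      simp only [hΛ]
      rw [← Set.Iic_union_Ioc_eq_Iic hst, setIntegral_union _ measurableSet_Ioc
        (hli ω).integrableOn (hli ω).integrableOn]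
      exact Set.disjoint_left.2 fun u h1 h2 => not_lt.2 h1 h2.1
    have h2 := norm_setIntegral_le_of_norm_le_const (μ := volume) (s := Set.Ioc s t)
      (f := fun u => l u ω) (C := C) (measure_lt_top _ _)
      (fun u _ => by rw [Real.norm_eq_abs, abs_of_nonneg (hl0 u ω)]; exact hlC u ω)
    rw [measureReal_def, volume_Ioc_time, ENNReal.toReal_ofReal (by linarith)] at h2
    have h3 := le_abs_self (∫ u in Set.Ioc s t, l u ω)
    rw [Real.norm_eq_abs] at h2
    linarith
  have hset : ∫ ω in A, ((n t ω : ℝ) - n s ω) ∂P = ∫ ω in A, (Λ t ω - Λ s ω) ∂P := by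
    have h1 := hmart.setIntegral_eq hst hA
    rw [integral_sub (hni s).integrableOn (hΛi s).integrableOn,
      integral_sub (hni t).integrableOn (hΛi t).integrableOn] at h1
    rw [integral_sub (hni t).integrableOn (hni s).integrableOn,
      integral_sub (hΛi t).integrableOn (hΛi s).integrableOn]
    linarith
  have hle : ∫ ω in A, ((n t ω : ℝ) - n s ω) ∂P ≤ C * ((t : ℝ) - s) * P.real A := by
    rw [hset]
    refine (setIntegral_mono ((hΛi t).sub (hΛi s)).integrableOn (integrable_const _).integrableOn
      hinc).trans ?_
    rw [setIntegral_const, smul_eq_mul, mul_comm]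
  have hcast : ∀ ω, ((n t ω - n s ω : ℕ) : ENNReal) = ENNReal.ofReal ((n t ω : ℝ) - n s ω) := by
    intro ω
    rw [← Nat.cast_sub (hmono ω hst), ENNReal.ofReal_natCast]
  simp_rw [hcast]
  rw [← ofReal_integral_eq_lintegral_ofReal (f := fun ω => (n t ω : ℝ) - n s ω)
    ((hni t).sub (hni s)).integrableOn
    (Eventually.of_forall fun ω => sub_nonneg.2 (by exact_mod_cast hmono ω hst))]
  refine (ENNReal.ofReal_le_ofReal hle).trans ?_
  rw [ENNReal.ofReal_mul (mul_nonneg hC (by linarith)), measureReal_def,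
    ENNReal.ofReal_toReal (measure_ne_top _ _)]

end Counting

/-! ### Riemann sums of payment streams -/

section PaymentSum

variable {T : ℝ} [hT : Fact (0 < T)] {Ω : Type*} {mΩ : MeasurableSpace Ω} {m : ℕ}

/-- The increment of a counting process over a grid cell, truncated at one. -/
noncomputable def cellJump (x : Time T → Ω → ℕ) (n i : ℕ) (ω : Ω) : ℝ :=
  ((min (x (grid n (i + 1)) ω - x (grid n i) ω) 1 : ℕ) : ℝ)

/-- The Riemann sum of the payment stream `a dt + ∑_{k,j} b^{kj} dN^{kj}` along the uniform
grid. -/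
noncomputable def paymentSum (N : Fin m → Fin m → Time T → Ω → ℕ) (a : Time T → Ω → ℝ)
    (b : Fin m → Fin m → Time T → Ω → ℝ) (n : ℕ) (ω : Ω) : ℝ :=
  ∑ i ∈ Finset.range (n + 1), (a (grid n i) ω * (T / (n + 1)) +
    ∑ k, ∑ j, b k j (grid n i) ω * cellJump (N k j) n i ω)

lemma cellJump_nonneg (x : Time T → Ω → ℕ) (n i : ℕ) (ω : Ω) : 0 ≤ cellJump x n i ω :=
  Nat.cast_nonneg _

lemma cellJump_le_one (x : Time T → Ω → ℕ) (n i : ℕ) (ω : Ω) : cellJump x n i ω ≤ 1 := by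
  unfold cellJump; exact_mod_cast min_le_right _ _

variable {𝓕 : Filtration (Time T) mΩ} {P : Measure Ω}

lemma measurable_cellJump {x : Time T → Ω → ℕ} (hx : Adapted 𝓕 x) (n i : ℕ) :
    Measurable[𝓕 (grid n (i + 1))] (cellJump x n i) := by
  have h1 := hx (grid n (i + 1))
  have h2 := (hx (grid n i)).mono (𝓕.mono (grid_mono n i.le_succ)) le_rfl
  have h3 : Measurable fun p : ℕ × ℕ => ((min (p.1 - p.2) 1 : ℕ) : ℝ) := .of_discrete
  exact h3.comp (h1.prodMk h2)

lemma measurable_paymentSum {N : Fin m → Fin m → Time T → Ω → ℕ}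
    (hN : ∀ k j, Adapted 𝓕 (N k j)) {a : Time T → Ω → ℝ} (ha : ∀ t, Measurable (a t))
    {b : Fin m → Fin m → Time T → Ω → ℝ} (hb : ∀ k j t, Measurable (b k j t)) (n : ℕ) :
    Measurable (paymentSum N a b n) := by
  refine Finset.measurable_sum _ fun i _ => ((ha _).mul_const _).add ?_
  refine Finset.measurable_sum _ fun k _ => Finset.measurable_sum _ fun j _ => ?_
  exact (hb k j _).mul ((measurable_cellJump (hN k j) n i).mono (𝓕.le _) le_rfl)

/-- The Riemann sums of a left-continuous payment stream converge pathwise. -/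
lemma tendsto_paymentSum {N : Fin m → Fin m → Time T → Ω → ℕ} (hN : IsPointProcess 𝓕 N)
    {a : Time T → Ω → ℝ} {b : Fin m → Fin m → Time T → Ω → ℝ} {ω : Ω}
    (ha : LeftCts fun u => a u ω) {C : ℝ} (haC : ∀ u, |a u ω| ≤ C)
    (hb : ∀ k j, LeftCts fun u => b k j u ω) :
    Tendsto (fun n => paymentSum N a b n ω) atTop (𝓝 ((∫ u, a u ω) +
      ∑ k, ∑ j, jumpIntegral (fun u => b k j u ω) (fun u => N k j u ω) Set.univ)) := by
  have h1 := (ha.integrable_and_tendsto haC).2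
  have h2 : ∀ k j, Tendsto (fun n => ∑ i ∈ Finset.range (n + 1),
      b k j (grid n i) ω * cellJump (N k j) n i ω) atTop
      (𝓝 (jumpIntegral (fun u => b k j u ω) (fun u => N k j u ω) Set.univ)) := fun k j =>
    tendsto_jumpIntegral (hN.mono k j ω) (fun t => (hN.rcll k j ω t).1) (hN.unit_jump k j ω)
      (hb k j)
  refine (h1.add (tendsto_finsetSum Finset.univ fun k _ =>
    tendsto_finsetSum Finset.univ fun j _ => h2 k j)).congr fun n => ?_
  unfold paymentSum
  rw [Finset.sum_add_distrib]
  congr 1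
  symm
  rw [Finset.sum_comm]
  refine Finset.sum_congr rfl fun k _ => ?_
  rw [Finset.sum_comm]

/-- `N` is a family of adapted nondecreasing counting processes whose increments over `(s, t]`
have `𝓕 s`-conditional mean at most `C (t - s)`, in weighted form. -/
structure HasIncrementBound (𝓕 : Filtration (Time T) mΩ) (P : Measure Ω)
    (N : Fin m → Fin m → Time T → Ω → ℕ) (C : ℝ) : Prop where
  nonneg : 0 ≤ C
  adapted : ∀ k j, Adapted 𝓕 (N k j)
  bound : ∀ k j, ∀ s t : Time T, s ≤ t → ∀ ζ : Ω → ENNReal, Measurable[𝓕 s] ζ →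
    ∫⁻ ω, ζ ω * ((N k j t ω - N k j s ω : ℕ) : ENNReal) ∂P ≤
      ENNReal.ofReal (C * ((t : ℝ) - s)) * ∫⁻ ω, ζ ω ∂P

/-- Second moment of payment sums with an adapted majorant `H` of the payment rates. -/
lemma HasIncrementBound.lintegral_sq_paymentSum_le {N : Fin m → Fin m → Time T → Ω → ℕ} {C : ℝ}
    (hN : HasIncrementBound 𝓕 P N C) :
    ∃ K : NNReal, ∀ (a : Time T → Ω → ℝ) (b : Fin m → Fin m → Time T → Ω → ℝ)
      (H : Time T → Ω → ℝ), (∀ t, Measurable[𝓕 t] (H t)) →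
      (∀ᵐ ω ∂P, ∀ t, |a t ω| ≤ H t ω ∧ ∀ k j, |b k j t ω| ≤ H t ω) → ∀ n : ℕ,
      ∫⁻ ω, ENNReal.ofReal (paymentSum N a b n ω ^ 2) ∂P ≤
        K * ∑ i ∈ Finset.range (n + 1),
          ENNReal.ofReal (T / (n + 1)) * ∫⁻ ω, ENNReal.ofReal (H (grid n i) ω ^ 2) ∂P := by
  have h0 := hT.out
  have hC := hN.nonneg
  set c : ℝ := 1 + m * (m * C) with hc
  have hc0 : 0 ≤ c := by positivity
  set B : ℝ := T + m * m with hB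
  have hB0 : 0 ≤ B := by positivity
  refine ⟨Real.toNNReal (Real.exp (c * T)) * (1 + Real.toNNReal B) * Real.toNNReal c,
    fun a b H hH hab n => ?_⟩
  have hn : (0 : ℝ) < n + 1 := by positivity
  -- the increments of the clock `t + ∑ N^{kj}`, with truncated jumps
  set x : ℕ → Ω → ℝ := fun i ω => T / (n + 1) + ∑ k, ∑ j, cellJump (N k j) n i ω with hx
  have hx0 : ∀ i ω, 0 ≤ x i ω := fun i ω => add_nonneg (by positivity)
    (Finset.sum_nonneg fun k _ => Finset.sum_nonneg fun j _ => cellJump_nonneg _ _ _ _)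
  have hxB : ∀ i ω, x i ω ≤ B := by
    intro i ω
    refine add_le_add (div_le_self h0.le (by linarith)) ?_
    calc ∑ k, ∑ j, cellJump (N k j) n i ω ≤ ∑ k : Fin m, ∑ j : Fin m, (1 : ℝ) := by
          gcongr; exact cellJump_le_one _ _ _ _
      _ = m * m := by simp
  have hxm : ∀ i < n + 1, Measurable[𝓕 (grid n (i + 1))] (x i) := fun i _ =>
    measurable_const.add (Finset.measurable_sum _ fun k _ => Finset.measurable_sum _ fun j _ =>
      measurable_cellJump (hN.adapted k j) n i)
  set κ : ENNReal := ENNReal.ofReal (c * (T / (n + 1))) with hκ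
  have hstep : ∀ i < n + 1, ∀ ζ : Ω → ENNReal, Measurable[𝓕 (grid n i)] ζ →
      ∫⁻ ω, ζ ω * ENNReal.ofReal (x i ω) ∂P ≤ κ * ∫⁻ ω, ζ ω ∂P := by
    intro i hi ζ hζ
    have hζ' : Measurable ζ := hζ.mono (𝓕.le _) le_rfl
    have hNm : ∀ k j, Measurable fun ω =>
        ζ ω * ((N k j (grid n (i + 1)) ω - N k j (grid n i) ω : ℕ) : ENNReal) := by
      intro k j
      have h1 := (hN.adapted k j (grid n (i + 1))).mono (𝓕.le _) le_rfl
      have h2 := (hN.adapted k j (grid n i)).mono (𝓕.le _) le_rfl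
      have h3 : Measurable fun p : ℕ × ℕ => ((p.1 - p.2 : ℕ) : ENNReal) := .of_discrete
      exact hζ'.mul (h3.comp (h1.prodMk h2))
    have hpt : ∀ ω, ζ ω * ENNReal.ofReal (x i ω) ≤ ζ ω * ENNReal.ofReal (T / (n + 1)) +
        ∑ k, ∑ j, ζ ω * ((N k j (grid n (i + 1)) ω - N k j (grid n i) ω : ℕ) : ENNReal) := by
      intro ω
      simp_rw [← Finset.mul_sum, ← mul_add]
      gcongr
      rw [hx, ENNReal.ofReal_add (by positivity) (Finset.sum_nonneg fun k _ =>
        Finset.sum_nonneg fun j _ => cellJump_nonneg _ _ _ _)]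
      gcongr
      rw [ENNReal.ofReal_sum_of_nonneg fun k _ =>
        Finset.sum_nonneg fun j _ => cellJump_nonneg _ _ _ _]
      gcongr with k _
      rw [ENNReal.ofReal_sum_of_nonneg fun j _ => cellJump_nonneg _ _ _ _]
      gcongr with j _
      rw [cellJump, ENNReal.ofReal_natCast]
      exact_mod_cast min_le_left _ _
    calc ∫⁻ ω, ζ ω * ENNReal.ofReal (x i ω) ∂P
        ≤ ∫⁻ ω, ζ ω * ENNReal.ofReal (T / (n + 1)) + ∑ k, ∑ j,
            ζ ω * ((N k j (grid n (i + 1)) ω - N k j (grid n i) ω : ℕ) : ENNReal) ∂P :=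
          lintegral_mono hpt
      _ = ENNReal.ofReal (T / (n + 1)) * ∫⁻ ω, ζ ω ∂P + ∑ k, ∑ j, ∫⁻ ω,
            ζ ω * ((N k j (grid n (i + 1)) ω - N k j (grid n i) ω : ℕ) : ENNReal) ∂P := by
          rw [lintegral_add_left (hζ'.mul_const _), lintegral_mul_const _ hζ',
            lintegral_finsetSum _ fun k _ => Finset.measurable_sum _ fun j _ => hNm k j, mul_comm]
          congr 1
          refine Finset.sum_congr rfl fun k _ => ?_
          rw [lintegral_finsetSum _ fun j _ => hNm k j]
      _ ≤ ENNReal.ofReal (T / (n + 1)) * ∫⁻ ω, ζ ω ∂P + ∑ k : Fin m, ∑ j : Fin m,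
            ENNReal.ofReal (C * (T / (n + 1))) * ∫⁻ ω, ζ ω ∂P := by
          gcongr with k _ j _
          rw [← grid_step hi]
          exact hN.bound k j _ _ (grid_mono n i.le_succ) ζ hζ
      _ = κ * ∫⁻ ω, ζ ω ∂P := by
          rw [hκ, hc]
          simp only [Finset.sum_const, Finset.card_univ, Fintype.card_fin, nsmul_eq_mul]
          have : (1 + m * (m * C)) * (T / ((n : ℝ) + 1)) =
            T / (n + 1) + m * (m * (C * (T / (n + 1)))) := by ring
          rw [this, ENNReal.ofReal_add (by positivity) (by positivity),
            ENNReal.ofReal_mul (p := (m : ℝ)) (by positivity),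
            ENNReal.ofReal_mul (p := (m : ℝ)) (by positivity), ENNReal.ofReal_natCast]
          ring
  have hmain := lintegral_sq_sum_le (P := P) (fun i => 𝓕 (grid n i))
    (fun i j hij => 𝓕.mono (grid_mono n hij)) (fun i => 𝓕.le _)
    (H := fun i ω => ENNReal.ofReal (H (grid n i) ω)) (ξ := fun i ω => ENNReal.ofReal (x i ω))
    (n + 1) (fun i _ => (hH _).ennreal_ofReal) (fun i hi => (hxm i hi).ennreal_ofReal)
    (κ := κ) (B := ENNReal.ofReal B) (fun i _ ω => ENNReal.ofReal_le_ofReal (hxB i ω)) hstep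
  have hleft : ∫⁻ ω, ENNReal.ofReal (paymentSum N a b n ω ^ 2) ∂P ≤
      ∫⁻ ω, (∑ i ∈ Finset.range (n + 1),
        ENNReal.ofReal (H (grid n i) ω) * ENNReal.ofReal (x i ω)) ^ 2 ∂P := by
    refine lintegral_mono_ae ?_
    filter_upwards [hab] with ω hω
    have hH0 : ∀ t, 0 ≤ H t ω := fun t => (abs_nonneg _).trans (hω t).1
    have h1 : |paymentSum N a b n ω| ≤ ∑ i ∈ Finset.range (n + 1), H (grid n i) ω * x i ω := by
      refine (Finset.abs_sum_le_sum_abs _ _).trans (Finset.sum_le_sum fun i _ => ?_)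
      rw [hx, mul_add, Finset.mul_sum]
      refine (abs_add_le _ _).trans (add_le_add ?_ ?_)
      · rw [abs_mul, abs_of_nonneg (show 0 ≤ T / ((n : ℝ) + 1) by positivity)]
        gcongr
        exact (hω _).1
      · refine (Finset.abs_sum_le_sum_abs _ _).trans (Finset.sum_le_sum fun k _ => ?_)
        rw [Finset.mul_sum]
        refine (Finset.abs_sum_le_sum_abs _ _).trans (Finset.sum_le_sum fun j _ => ?_)
        rw [abs_mul, abs_of_nonneg (cellJump_nonneg _ _ _ _)]
        exact mul_le_mul_of_nonneg_right ((hω _).2 k j) (cellJump_nonneg _ _ _ _)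
    have h2 : ∑ i ∈ Finset.range (n + 1),
        ENNReal.ofReal (H (grid n i) ω) * ENNReal.ofReal (x i ω) =
        ENNReal.ofReal (∑ i ∈ Finset.range (n + 1), H (grid n i) ω * x i ω) := by
      rw [ENNReal.ofReal_sum_of_nonneg fun i _ => mul_nonneg (hH0 _) (hx0 _ _)]
      exact Finset.sum_congr rfl fun i _ => (ENNReal.ofReal_mul (hH0 _)).symm
    rw [h2, ← sq_abs, ENNReal.ofReal_pow (abs_nonneg _)]
    gcongr
  have hpow : (1 + κ) ^ (n + 1) ≤ ENNReal.ofReal (Real.exp (c * T)) := by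
    rw [hκ, ← ENNReal.ofReal_one, ← ENNReal.ofReal_add zero_le_one (by positivity),
      ← ENNReal.ofReal_pow (by positivity)]
    refine ENNReal.ofReal_le_ofReal ?_
    calc (1 + c * (T / ((n : ℝ) + 1))) ^ (n + 1)
        ≤ Real.exp (c * (T / (n + 1))) ^ (n + 1) := by
          gcongr
          rw [add_comm]
          exact Real.add_one_le_exp _
      _ = Real.exp (c * T) := by
          rw [← Real.exp_nat_mul]
          congr 1
          push_cast
          field_simp
  refine hleft.trans (hmain.trans ?_)
  calc (1 + κ) ^ (n + 1) * ∑ i ∈ Finset.range (n + 1), (1 + ENNReal.ofReal B) * κ *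
        ∫⁻ ω, ENNReal.ofReal (H (grid n i) ω) ^ 2 ∂P
      ≤ ENNReal.ofReal (Real.exp (c * T)) * ∑ i ∈ Finset.range (n + 1),
        (1 + ENNReal.ofReal B) * κ * ∫⁻ ω, ENNReal.ofReal (H (grid n i) ω ^ 2) ∂P := by
        refine mul_le_mul' hpow (Finset.sum_le_sum fun i _ => ?_)
        gcongr with ω
        rcases le_total 0 (H (grid n i) ω) with h | h
        · rw [ENNReal.ofReal_pow h]
        · rw [ENNReal.ofReal_of_nonpos h]; simp
    _ = _ := by
        rw [hκ, ENNReal.ofReal_mul hc0]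
        simp only [ENNReal.coe_mul, ENNReal.coe_add, ENNReal.coe_one]
        simp only [← ENNReal.ofReal.eq_1]
        simp_rw [mul_assoc, ← Finset.mul_sum]

end PaymentSum

/-! ### Exponential moments of Itô integrals of bounded integrands -/

lemma lintegral_exp_pi_gaussianReal {r : ℕ} (h : Fin r → ℝ) (v : NNReal) :
    ∫⁻ y, ENNReal.ofReal (Real.exp (∑ j, h j * y j)) ∂(Measure.pi fun _ => gaussianReal 0 v) =
      ENNReal.ofReal (Real.exp (v * (∑ j, h j ^ 2) / 2)) := by
  simp_rw [Real.exp_sum]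
  have hi : Integrable (fun y : Fin r → ℝ => ∏ j, Real.exp (h j * y j))
      (Measure.pi fun _ => gaussianReal 0 v) :=
    Integrable.fintype_prod (f := fun j y => Real.exp (h j * y))
      fun j => integrable_exp_mul_gaussianReal (h j)
  rw [← ofReal_integral_eq_lintegral_ofReal hi
    (Eventually.of_forall fun y => Finset.prod_nonneg fun j _ => (Real.exp_pos _).le),
    integral_fintype_prod_eq_prod (f := fun j (y : ℝ) => Real.exp (h j * y))]
  congr 1
  have : ∀ j, ∫ y, Real.exp (h j * y) ∂(gaussianReal 0 v) = Real.exp (v * h j ^ 2 / 2) := by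
    intro j
    have := congrFun (mgf_fun_id_gaussianReal (μ := 0) (v := v)) (h j)
    simpa [mgf] using this
  simp_rw [this]
  rw [← Real.exp_sum, Finset.mul_sum, Finset.sum_div]

/-- Conditional exponential moment of a Gaussian increment that is independent of `m`, with an
`m`-measurable bounded coefficient. -/
lemma lintegral_mul_exp_le_of_indep {Ω : Type*} {m mΩ : MeasurableSpace Ω}
    {P : Measure Ω} [IsProbabilityMeasure P] (hm : m ≤ mΩ) {r : ℕ} {Z : Ω → Fin r → ℝ}
    (hZ : Measurable Z) (hind : Indep (MeasurableSpace.comap Z inferInstance) m P) {v : NNReal}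
    (hlaw : P.map Z = Measure.pi fun _ => gaussianReal 0 v) {ζ : Ω → ENNReal}
    (hζ : Measurable[m] ζ) {h : Ω → Fin r → ℝ} (hh : Measurable[m] h) {b : ℝ}
    (hb : ∀ ω, ∑ j, h ω j ^ 2 ≤ b) :
    ∫⁻ ω, ζ ω * ENNReal.ofReal (Real.exp (∑ j, h ω j * Z ω j)) ∂P ≤
      ENNReal.ofReal (Real.exp (v * b / 2)) * ∫⁻ ω, ζ ω ∂P := by
  have hpair : Measurable[m] fun ω => (ζ ω, h ω) := hζ.prodMk hh
  have hpair' : Measurable fun ω => (ζ ω, h ω) := hpair.mono hm le_rfl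
  have hI : IndepFun (fun ω => (ζ ω, h ω)) Z P :=
    (indep_of_indep_of_le_right hind hpair.comap_le).symm
  have hmap := hI.map_prod_eq_prod_map_map hpair'.aemeasurable hZ.aemeasurable
  set F : (ENNReal × (Fin r → ℝ)) × (Fin r → ℝ) → ENNReal :=
    fun q => q.1.1 * ENNReal.ofReal (Real.exp (∑ j, q.1.2 j * q.2 j)) with hF
  have hFm : Measurable F := by fun_prop
  calc ∫⁻ ω, ζ ω * ENNReal.ofReal (Real.exp (∑ j, h ω j * Z ω j)) ∂P
      = ∫⁻ q, F q ∂(P.map fun ω => ((ζ ω, h ω), Z ω)) :=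
        (lintegral_map hFm (hpair'.prodMk hZ)).symm
    _ = ∫⁻ ω, ∫⁻ y, F ((ζ ω, h ω), y) ∂(Measure.pi fun _ => gaussianReal 0 v) ∂P := by
        rw [hmap, hlaw, lintegral_prod _ hFm.aemeasurable, lintegral_map _ hpair']
        exact hFm.lintegral_prod_right'
    _ ≤ ∫⁻ ω, ENNReal.ofReal (Real.exp (v * b / 2)) * ζ ω ∂P := by
        refine lintegral_mono fun ω => ?_
        simp only [hF]
        rw [lintegral_const_mul _ (by fun_prop), lintegral_exp_pi_gaussianReal, mul_comm]
        gcongr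
        exact hb ω
    _ = _ := lintegral_const_mul _ (hζ.mono hm le_rfl)

section Ito

variable {T : ℝ} [hT : Fact (0 < T)] {Ω : Type*} {mΩ : MeasurableSpace Ω} {r : ℕ}

lemma riemannSum_sub (π : TimePartition T) (H W : Time T → Ω → Fin r → ℝ) (t : Time T) (ω : Ω) :
    riemannSum π H W ⊤ ω - riemannSum π H W t ω = ∑ i ∈ Finset.range π.n, ∑ j,
      H (π.pt i) ω j * (W (max (π.pt (i + 1)) t) ω j - W (max (π.pt i) t) ω j) := by
  have key : ∀ (x : Time T) (j : Fin r),
      W x ω j - W (min x t) ω j = W (max x t) ω j - W t ω j := by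
    intro x j
    rcases le_total x t with h | h
    · simp [h]
    · simp [h]
  unfold riemannSum
  rw [← Finset.sum_sub_distrib]
  refine Finset.sum_congr rfl fun i _ => ?_
  rw [← Finset.sum_sub_distrib]
  refine Finset.sum_congr rfl fun j _ => ?_
  have h1 := key (π.pt (i + 1)) j
  have h2 := key (π.pt i) j
  simp only [min_top_right]
  rw [← mul_sub]
  congr 1
  linarith

lemma riemannSum_bot (π : TimePartition T) (H W : Time T → Ω → Fin r → ℝ) (ω : Ω) :
    riemannSum π H W ⊥ ω = 0 := by
  simp [riemannSum]

variable {𝓕 : Filtration (Time T) mΩ} {P : Measure Ω}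

lemma lintegral_mul_exp_riemannSum_le [IsProbabilityMeasure P] {W : Time T → Ω → Fin r → ℝ}
    (hW : IsBrownianMotion 𝓕 P W) {H : Time T → Ω → Fin r → ℝ} (hH : ∀ t, Measurable[𝓕 t] (H t))
    {b : ℝ} (hb : ∀ t ω, ∑ j, H t ω j ^ 2 ≤ b) (π : TimePartition T) (t : Time T)
    {ζ : Ω → ENNReal} (hζ : Measurable[𝓕 t] ζ) :
    ∫⁻ ω, ζ ω * ENNReal.ofReal (Real.exp (riemannSum π H W ⊤ ω - riemannSum π H W t ω)) ∂P ≤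
      ENNReal.ofReal (Real.exp (T * b / 2)) * ∫⁻ ω, ζ ω ∂P := by
  have hWm : ∀ s, Measurable[𝓕 s] (W s) := fun s => (hW.adapted s).measurable
  set s : ℕ → Time T := fun i => max (π.pt i) t with hs
  have hsm : Monotone s := fun i j hij => max_le_max_right t (π.mono hij)
  have hb0 : 0 ≤ b := by
    obtain ⟨ω⟩ := nonempty_of_isProbabilityMeasure P
    exact (Finset.sum_nonneg fun j _ => sq_nonneg _).trans (hb t ω)
  have key : ∀ k, (Measurable[𝓕 (s k)] fun ω => ζ ω * ENNReal.ofReal (Real.exp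
        (∑ i ∈ Finset.range k, ∑ j, H (π.pt i) ω j * (W (s (i + 1)) ω j - W (s i) ω j)))) ∧
      ∫⁻ ω, ζ ω * ENNReal.ofReal (Real.exp
        (∑ i ∈ Finset.range k, ∑ j, H (π.pt i) ω j * (W (s (i + 1)) ω j - W (s i) ω j))) ∂P ≤
      ENNReal.ofReal (Real.exp (((s k : ℝ) - t) * b / 2)) * ∫⁻ ω, ζ ω ∂P := by
    intro k
    induction k with
    | zero =>
      refine ⟨?_, ?_⟩
      · simp only [Finset.range_zero, Finset.sum_empty]
        exact (hζ.mono (𝓕.mono (le_max_right _ _)) le_rfl).mul_const _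
      · simp only [Finset.range_zero, Finset.sum_empty, Real.exp_zero, ENNReal.ofReal_one, mul_one]
        refine le_mul_of_one_le_left' ?_
        rw [ENNReal.one_le_ofReal]
        refine Real.one_le_exp ?_
        have : (t : ℝ) ≤ s 0 := le_max_right (π.pt 0) t
        have := sub_nonneg.2 this
        positivity
    | succ k ih =>
      obtain ⟨ihm, ihb⟩ := ih
      have hle : 𝓕 (s k) ≤ 𝓕 (s (k + 1)) := 𝓕.mono (hsm k.le_succ)
      have hHk : Measurable[𝓕 (s k)] (H (π.pt k)) :=
        (hH _).mono (𝓕.mono (le_max_left _ _)) le_rfl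
      have hrw : ∀ ω, ζ ω * ENNReal.ofReal (Real.exp (∑ i ∈ Finset.range (k + 1),
          ∑ j, H (π.pt i) ω j * (W (s (i + 1)) ω j - W (s i) ω j))) =
          ζ ω * ENNReal.ofReal (Real.exp (∑ i ∈ Finset.range k,
          ∑ j, H (π.pt i) ω j * (W (s (i + 1)) ω j - W (s i) ω j))) *
          ENNReal.ofReal (Real.exp
            (∑ j, H (π.pt k) ω j * (W (s (k + 1)) ω - W (s k) ω) j)) := by
        intro ω
        rw [Finset.sum_range_succ, Real.exp_add, ENNReal.ofReal_mul (Real.exp_pos _).le, mul_assoc]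
        rfl
      simp_rw [hrw]
      constructor
      · refine (ihm.mono hle le_rfl).mul ?_
        have hd : Measurable[𝓕 (s (k + 1))] fun ω => W (s (k + 1)) ω - W (s k) ω :=
          (hWm _).sub ((hWm _).mono hle le_rfl)
        refine (Real.measurable_exp.comp (Finset.measurable_sum _ fun j _ => ?_)).ennreal_ofReal
        exact ((measurable_pi_apply j).comp (hHk.mono hle le_rfl)).mul
          ((measurable_pi_apply j).comp hd)
      · have hZ : Measurable fun ω => W (s (k + 1)) ω - W (s k) ω :=
          ((hWm _).mono (𝓕.le _) le_rfl).sub ((hWm _).mono (𝓕.le _) le_rfl)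
        refine (lintegral_mul_exp_le_of_indep (𝓕.le (s k)) hZ
          (hW.indep _ _ (hsm k.le_succ)) (hW.law _ _ (hsm k.le_succ)) ihm hHk
          (hb (π.pt k))).trans ?_
        refine (mul_le_mul_right ihb _).trans ?_
        have h1 : (s k : ℝ) ≤ s (k + 1) := hsm k.le_succ
        rw [← mul_assoc, ← ENNReal.ofReal_mul (Real.exp_pos _).le, ← Real.exp_add,
          Real.coe_toNNReal _ (by linarith)]
        refine mul_le_mul_left (ENNReal.ofReal_le_ofReal (Real.exp_le_exp.2 (le_of_eq ?_))) _
        ring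
  simp_rw [riemannSum_sub]
  refine (key π.n).2.trans ?_
  refine mul_le_mul_left (ENNReal.ofReal_le_ofReal (Real.exp_le_exp.2 ?_)) _
  have h1 : (s π.n : ℝ) ≤ T := (s π.n).2.2
  have h2 : (0 : ℝ) ≤ t := t.2.1
  gcongr
  linarith

lemma IsItoIntegral.exists_seq_tendsto {H W : Time T → Ω → Fin r → ℝ} {X : Time T → Ω → ℝ}
    (hX : IsItoIntegral 𝓕 P H W X) (s t : Time T) :
    ∃ ns : ℕ → ℕ, ∀ᵐ ω ∂P,
      Tendsto (fun n => riemannSum (gridPartition T (ns n)) H W s ω) atTop (𝓝 (X s ω)) ∧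
      Tendsto (fun n => riemannSum (gridPartition T (ns n)) H W t ω) atTop (𝓝 (X t ω)) := by
  have h : TendstoInMeasure P (fun n ω => (riemannSum (gridPartition T n) H W s ω,
      riemannSum (gridPartition T n) H W t ω)) atTop (fun ω => (X s ω, X t ω)) := by
    rw [tendstoInMeasure_iff_norm]
    intro ε hε
    rw [ENNReal.tendsto_nhds_zero]
    intro δ hδ
    obtain ⟨δ', hδ'0, hδ'⟩ : ∃ δ' : ℝ, 0 < δ' ∧ ENNReal.ofReal δ' ≤ δ := by
      rcases eq_or_ne δ ⊤ with rfl | h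
      · exact ⟨1, one_pos, le_top⟩
      · exact ⟨δ.toReal, ENNReal.toReal_pos hδ.ne' h, ENNReal.ofReal_toReal_le⟩
    obtain ⟨ρ, hρ, hπ⟩ := hX.ucp (min (ε / 2) δ') (by positivity)
    filter_upwards [(tendsto_mesh T).eventually (gt_mem_nhds hρ)] with n hn
    refine le_trans (measure_mono ?_) ((hπ (gridPartition T n) fun i hi => ?_).trans
      ((ENNReal.ofReal_le_ofReal (min_le_right _ _)).trans hδ'))
    · intro ω hω
      have hω' : ε ≤ ‖(riemannSum (gridPartition T n) H W s ω - X s ω,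
        riemannSum (gridPartition T n) H W t ω - X t ω)‖ := hω
      rw [Prod.norm_mk, le_max_iff, Real.norm_eq_abs, Real.norm_eq_abs] at hω'
      have h2 : min (ε / 2) δ' < ε := (min_le_left _ _).trans_lt (by linarith)
      rcases hω' with h | h
      · exact ⟨s, h2.trans_le h⟩
      · exact ⟨t, h2.trans_le h⟩
    · exact (grid_step hi).trans_le hn.le
  obtain ⟨ns, _, hns⟩ := h.exists_seq_tendsto_ae
  refine ⟨ns, ?_⟩
  filter_upwards [hns] with ω hω
  rw [Prod.tendsto_iff] at hω
  exact hω

lemma IsItoIntegral.ae_bot_eq_zero {H W : Time T → Ω → Fin r → ℝ} {X : Time T → Ω → ℝ}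
    (hX : IsItoIntegral 𝓕 P H W X) : ∀ᵐ ω ∂P, X ⊥ ω = 0 := by
  obtain ⟨ns, hns⟩ := hX.exists_seq_tendsto ⊥ ⊥
  filter_upwards [hns] with ω hω
  refine tendsto_nhds_unique hω.1 ?_
  simp [riemannSum_bot]

/-- Conditional exponential moments of increments of the Itô integral of a bounded integrand,
by Fatou's lemma along Riemann sums. -/
lemma IsItoIntegral.lintegral_mul_exp_le [IsProbabilityMeasure P] {W : Time T → Ω → Fin r → ℝ}
    (hW : IsBrownianMotion 𝓕 P W) {H : Time T → Ω → Fin r → ℝ} (hH : ∀ t, Measurable[𝓕 t] (H t))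
    {b : ℝ} (hb : ∀ t ω, ∑ j, H t ω j ^ 2 ≤ b) {X : Time T → Ω → ℝ}
    (hX : IsItoIntegral 𝓕 P H W X) (a : ℝ) (t : Time T) {ζ : Ω → ENNReal}
    (hζ : Measurable[𝓕 t] ζ) :
    ∫⁻ ω, ζ ω * ENNReal.ofReal (Real.exp (a * (X ⊤ ω - X t ω))) ∂P ≤
      ENNReal.ofReal (Real.exp (T * (a ^ 2 * b) / 2)) * ∫⁻ ω, ζ ω ∂P := by
  obtain ⟨ns, hns⟩ := hX.exists_seq_tendsto ⊤ t
  set R : ℕ → Ω → ℝ := fun n ω => riemannSum (gridPartition T (ns n)) H W ⊤ ω -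
    riemannSum (gridPartition T (ns n)) H W t ω with hR
  have hWm : ∀ s, Measurable (W s) := fun s => ((hW.adapted s).mono (𝓕.le s)).measurable
  have hrm : ∀ n s, Measurable (riemannSum (gridPartition T n) H W s) := fun n s =>
    Finset.measurable_sum _ fun i _ => Finset.measurable_sum _ fun j _ =>
      ((measurable_pi_apply j).comp ((hH _).mono (𝓕.le _) le_rfl)).mul
        (((measurable_pi_apply j).comp (hWm _)).sub ((measurable_pi_apply j).comp (hWm _)))
  have hζ' : Measurable ζ := hζ.mono (𝓕.le t) le_rfl
  have hscale : ∀ n ω, a * R n ω =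
      riemannSum (gridPartition T (ns n)) (fun u ω j => a * H u ω j) W ⊤ ω -
      riemannSum (gridPartition T (ns n)) (fun u ω j => a * H u ω j) W t ω := by
    intro n ω
    simp only [hR, riemannSum, mul_sub, Finset.mul_sum, mul_assoc]
  have hbd : ∀ n, ∫⁻ ω, ζ ω * ENNReal.ofReal (Real.exp (a * R n ω)) ∂P ≤
      ENNReal.ofReal (Real.exp (T * (a ^ 2 * b) / 2)) * ∫⁻ ω, ζ ω ∂P := by
    intro n
    simp_rw [hscale]
    refine lintegral_mul_exp_riemannSum_le hW (fun s => ?_) (fun s ω => ?_) _ t hζ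
    · exact (hH s).const_smul a
    · simp_rw [mul_pow, ← Finset.mul_sum]
      exact mul_le_mul_of_nonneg_left (hb s ω) (sq_nonneg a)
  have hexpm : ∀ n, Measurable fun ω => ENNReal.ofReal (Real.exp (a * R n ω)) := fun n =>
    (Real.measurable_exp.comp (((hrm _ _).sub (hrm _ _)).const_mul a)).ennreal_ofReal
  refine lintegral_le_of_tendsto (fun n => hζ'.mul (hexpm n)) ?_ hbd tendsto_const_nhds
  filter_upwards [hns] with ω hω
  refine ENNReal.Tendsto.const_mul (ENNReal.tendsto_ofReal ?_)
    (Or.inl (ENNReal.ofReal_pos.2 (Real.exp_pos _)).ne')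
  exact (Real.continuous_exp.tendsto _).comp ((hω.1.sub hω.2).const_mul a)

end Ito

/-! ### An `L²` bound for conditional expectations under a change of measure -/

section ChangeOfMeasure

variable {Ω : Type*} {m mΩ : MeasurableSpace Ω} {P : Measure Ω}

lemma sq_lintegral_mul_le {f g : Ω → ENNReal} (hf : AEMeasurable f P) (hg : AEMeasurable g P) :
    (∫⁻ ω, f ω * g ω ∂P) ^ 2 ≤ (∫⁻ ω, f ω ^ 2 ∂P) * ∫⁻ ω, g ω ^ 2 ∂P := by
  have h := ENNReal.lintegral_mul_le_Lp_mul_Lq P Real.HolderConjugate.two_two hf hg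
  simp only [Pi.mul_apply, ENNReal.rpow_two] at h
  refine (pow_le_pow_left' h 2).trans (le_of_eq ?_)
  rw [mul_pow, ← ENNReal.rpow_two, ← ENNReal.rpow_two, ← ENNReal.rpow_mul, ← ENNReal.rpow_mul]
  norm_num

lemma integrable_withDensity_of_sq {Z G : Ω → ℝ} (hZ : Measurable Z)
    (hZ2 : ∫⁻ ω, ENNReal.ofReal (Z ω ^ 2) ∂P ≠ ⊤) (hG : AEMeasurable G P)
    (hG2 : ∫⁻ ω, ENNReal.ofReal (G ω ^ 2) ∂P ≠ ⊤) :
    Integrable G (P.withDensity fun ω => ENNReal.ofReal (Z ω)) := by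
  refine ⟨(hG.mono_ac (withDensity_absolutelyContinuous _ _)).aestronglyMeasurable, ?_⟩
  rw [hasFiniteIntegral_iff_enorm,
    lintegral_withDensity_eq_lintegral_mul₀ hZ.ennreal_ofReal.aemeasurable hG.enorm]
  have h := sq_lintegral_mul_le (P := P) hZ.ennreal_ofReal.aemeasurable hG.enorm
  have h1 : ∫⁻ ω, ENNReal.ofReal (Z ω) ^ 2 ∂P ≤ ∫⁻ ω, ENNReal.ofReal (Z ω ^ 2) ∂P := by
    refine lintegral_mono fun ω => ?_
    rcases le_total 0 (Z ω) with h | h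
    · rw [ENNReal.ofReal_pow h]
    · rw [ENNReal.ofReal_of_nonpos h]; simp
  have h2 : ∫⁻ ω, ‖G ω‖ₑ ^ 2 ∂P = ∫⁻ ω, ENNReal.ofReal (G ω ^ 2) ∂P := by
    refine lintegral_congr fun ω => ?_
    rw [← sq_abs, ENNReal.ofReal_pow (abs_nonneg _), Real.enorm_eq_ofReal_abs]
  rw [h2] at h
  have h3 := h.trans (mul_le_mul_left h1 _)
  have h4 := h3.trans_lt (ENNReal.mul_lt_top hZ2.lt_top hG2.lt_top)
  simpa [ENNReal.pow_lt_top_iff] using h4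

/-- If the density `Z` factors as `Z = E R` with `E` measurable for `m`, and `R²` and `R⁻¹` have
bounded conditional expectation given `m`, then `Q[· | m]` is bounded in `L²(P)`. This follows by
testing the conditional expectation against `U / E`; no formula for `P[Z | m]` is needed. -/
lemma lintegral_sq_condExp_withDensity_le (hm : m ≤ mΩ) {Z E : Ω → ℝ} (hZ : Measurable Z)
    (hZ0 : ∀ ω, 0 < Z ω) (hE : Measurable[m] E) (hE0 : ∀ ω, 0 < E ω) {C : NNReal}
    (hR2 : ∀ ζ : Ω → ENNReal, Measurable[m] ζ →
      ∫⁻ ω, ζ ω * ENNReal.ofReal ((Z ω / E ω) ^ 2) ∂P ≤ C * ∫⁻ ω, ζ ω ∂P)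
    (hRi : ∀ ζ : Ω → ENNReal, Measurable[m] ζ →
      ∫⁻ ω, ζ ω * ENNReal.ofReal (E ω / Z ω) ∂P ≤ C * ∫⁻ ω, ζ ω ∂P)
    [IsFiniteMeasure P] [IsFiniteMeasure (P.withDensity fun ω => ENNReal.ofReal (Z ω))]
    {U G : Ω → ℝ} (hU : Measurable[m] U) {K : ℝ} (hK : ∀ᵐ ω ∂P, |U ω| ≤ K)
    (hG : AEMeasurable G P)
    (hGi : Integrable G (P.withDensity fun ω => ENNReal.ofReal (Z ω)))
    (hUG : U =ᵐ[P.withDensity fun ω => ENNReal.ofReal (Z ω)]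
      (P.withDensity fun ω => ENNReal.ofReal (Z ω))[G | m]) :
    ∫⁻ ω, ENNReal.ofReal (U ω ^ 2) ∂P ≤ C ^ 3 * ∫⁻ ω, ENNReal.ofReal (G ω ^ 2) ∂P := by
  set Q := P.withDensity fun ω => ENNReal.ofReal (Z ω) with hQ
  have hQP : Q ≪ P := withDensity_absolutelyContinuous _ _
  have hE' : Measurable E := hE.mono hm le_rfl
  have hU' : Measurable U := hU.mono hm le_rfl
  -- localize to the set where `E⁻¹ ≤ n`
  set A : ℕ → Set Ω := fun n => {ω | (E ω)⁻¹ ≤ n} with hA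
  have hAm : ∀ n, MeasurableSet[m] (A n) := fun n => measurableSet_le hE.inv measurable_const
  set V : ℕ → Ω → ℝ := fun n => (A n).indicator U with hV
  have hVm : ∀ n, Measurable[m] (V n) := fun n => hU.indicator (hAm n)
  have hV' : ∀ n, Measurable (V n) := fun n => (hVm n).mono hm le_rfl
  have hVU : ∀ n ω, V n ω * U ω = V n ω ^ 2 := by
    intro n ω
    by_cases h : ω ∈ A n
    · simp [hV, h, sq]
    · simp [hV, h]
  have hVle : ∀ n ω, V n ω ^ 2 ≤ U ω ^ 2 := by
    intro n ω
    by_cases h : ω ∈ A n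
    · simp [hV, h]
    · simp [hV, h, sq_nonneg]
  have main : ∀ n, ∫⁻ ω, ENNReal.ofReal (V n ω ^ 2) ∂P ≤
      C ^ 3 * ∫⁻ ω, ENNReal.ofReal (G ω ^ 2) ∂P := by
    intro n
    set v := ∫⁻ ω, ENNReal.ofReal (V n ω ^ 2) ∂P with hv
    set w := ∫⁻ ω, ENNReal.ofReal (G ω ^ 2) ∂P with hw
    set x := ∫⁻ ω, ENNReal.ofReal (Z ω / E ω * V n ω ^ 2) ∂P with hx
    have hvtop : v ≠ ⊤ := by
      refine ((lintegral_mono_ae (g := fun _ => ENNReal.ofReal (K ^ 2)) ?_).trans_lt ?_).ne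
      · filter_upwards [hK] with ω hω
        refine ENNReal.ofReal_le_ofReal ((hVle n ω).trans ?_)
        rw [← sq_abs]
        exact pow_le_pow_left₀ (abs_nonneg _) hω 2
      · rw [lintegral_const]
        exact ENNReal.mul_lt_top ENNReal.ofReal_lt_top (measure_lt_top _ _)
    set ξ : Ω → ℝ := fun ω => V n ω / E ω with hξ
    have hξm : Measurable[m] ξ := (hVm n).div hE
    have hξb : ∀ᵐ ω ∂Q, ‖ξ ω‖ ≤ K * n := by
      filter_upwards [hQP.ae_le hK] with ω hω
      have hK0 : 0 ≤ K := (abs_nonneg _).trans hω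
      by_cases h : ω ∈ A n
      · simp only [hξ, hV, Set.indicator_of_mem h]
        rw [div_eq_mul_inv, norm_mul, Real.norm_eq_abs, Real.norm_eq_abs,
          abs_of_pos (inv_pos.2 (hE0 ω))]
        exact mul_le_mul hω h (inv_pos.2 (hE0 ω)).le hK0
      · simp only [hξ, hV, Set.indicator_of_notMem h]
        simp only [zero_div, norm_zero]
        positivity
    have hUi : Integrable U Q :=
      .of_bound hU'.aestronglyMeasurable K (hQP.ae_le hK)
    have htest : ∫ ω, ξ ω * U ω ∂Q = ∫ ω, ξ ω * G ω ∂Q := by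
      have h1 := condExp_stronglyMeasurable_mul_of_bound hm hξm.stronglyMeasurable hGi _ hξb
      rw [← integral_condExp (f := fun ω => ξ ω * G ω) hm]
      refine integral_congr_ae ?_
      filter_upwards [h1, hUG] with ω h1 h2
      rw [h2]
      exact h1.symm
    have hξU0 : ∀ ω, ξ ω * U ω = V n ω ^ 2 / E ω := fun ω => by
      rw [hξ, div_mul_eq_mul_div, hVU]
    have hx1 : x ≤ ∫⁻ ω, (ENNReal.ofReal (Z ω / E ω) * ENNReal.ofReal |V n ω|) *
        ENNReal.ofReal |G ω| ∂P := by
      have hm1 : Measurable fun ω => ξ ω * U ω := (hξm.mono hm le_rfl).mul hU'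
      have hm2 : AEMeasurable (fun ω => ‖ξ ω * G ω‖ₑ) P :=
        ((hξm.mono hm le_rfl).aemeasurable.mul hG).enorm
      have e1 : x = ∫⁻ ω, ENNReal.ofReal (ξ ω * U ω) ∂Q := by
        rw [hQ, lintegral_withDensity_eq_lintegral_mul _ hZ.ennreal_ofReal hm1.ennreal_ofReal]
        refine lintegral_congr fun ω => ?_
        rw [Pi.mul_apply, ← ENNReal.ofReal_mul (hZ0 ω).le, hξU0]
        congr 1; ring
      have e2 : ∫⁻ ω, ENNReal.ofReal (ξ ω * U ω) ∂Q = ENNReal.ofReal (∫ ω, ξ ω * U ω ∂Q) := by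
        rw [ofReal_integral_eq_lintegral_ofReal]
        · exact hUi.bdd_mul (hξm.mono hm le_rfl).aestronglyMeasurable hξb
        · exact Eventually.of_forall fun ω => by
            simp only [hξU0]; exact div_nonneg (sq_nonneg _) (hE0 ω).le
      have e3 : ENNReal.ofReal (∫ ω, ξ ω * G ω ∂Q) ≤ ∫⁻ ω, ‖ξ ω * G ω‖ₑ ∂Q := by
        refine (ENNReal.ofReal_le_ofReal (le_abs_self _)).trans ?_
        rw [← Real.enorm_eq_ofReal_abs]
        exact enorm_integral_le_lintegral_enorm _
      rw [e1, e2, htest]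
      refine e3.trans (le_of_eq ?_)
      rw [hQ, lintegral_withDensity_eq_lintegral_mul₀ hZ.ennreal_ofReal.aemeasurable hm2]
      refine lintegral_congr fun ω => ?_
      rw [Pi.mul_apply, enorm_mul, Real.enorm_eq_ofReal_abs, Real.enorm_eq_ofReal_abs, ← mul_assoc,
        ← ENNReal.ofReal_mul (hZ0 ω).le,
        ← ENNReal.ofReal_mul (div_pos (hZ0 ω) (hE0 ω)).le]
      congr 2
      rw [hξ, abs_div, abs_of_pos (hE0 ω)]
      ring
    have hRm : Measurable fun ω => Z ω / E ω := hZ.div hE'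
    have hx2 : x ^ 2 ≤ C * v * w := by
      refine (pow_le_pow_left' hx1 2).trans ((sq_lintegral_mul_le ?_ ?_).trans ?_)
      · exact (hRm.ennreal_ofReal.mul ((hV' n).abs.ennreal_ofReal)).aemeasurable
      · exact hG.abs.ennreal_ofReal
      · refine mul_le_mul' ?_ (le_of_eq ?_)
        · refine le_trans (le_of_eq (lintegral_congr fun ω => ?_))
            (hR2 (fun ω => ENNReal.ofReal (V n ω ^ 2)) ((hVm n).pow_const 2).ennreal_ofReal)
          rw [mul_pow, ← ENNReal.ofReal_pow (div_pos (hZ0 ω) (hE0 ω)).le,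
            ← ENNReal.ofReal_pow (abs_nonneg _), sq_abs, mul_comm]
        · refine lintegral_congr fun ω => ?_
          rw [← ENNReal.ofReal_pow (abs_nonneg _), sq_abs]
    have hv2 : v ^ 2 ≤ x * (C * v) := by
      have e1 : v = ∫⁻ ω, ENNReal.ofReal (√(Z ω / E ω) * |V n ω|) *
          ENNReal.ofReal (√(E ω / Z ω) * |V n ω|) ∂P := by
        refine lintegral_congr fun ω => ?_
        rw [← ENNReal.ofReal_mul (by positivity)]
        congr 1
        have : √(Z ω / E ω) * √(E ω / Z ω) = 1 := by
          rw [← Real.sqrt_mul (div_pos (hZ0 ω) (hE0 ω)).le, div_mul_div_cancel₀ (hE0 ω).ne',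
            div_self (hZ0 ω).ne', Real.sqrt_one]
        calc V n ω ^ 2 = |V n ω| ^ 2 * (√(Z ω / E ω) * √(E ω / Z ω)) := by
              rw [this, mul_one, sq_abs]
          _ = _ := by ring
      rw [e1]
      have hm1 : Measurable fun ω => √(Z ω / E ω) * |V n ω| := hRm.sqrt.mul (hV' n).abs
      have hm2 : Measurable fun ω => √(E ω / Z ω) * |V n ω| :=
        (hE'.div hZ).sqrt.mul (hV' n).abs
      refine (sq_lintegral_mul_le hm1.ennreal_ofReal.aemeasurable
        hm2.ennreal_ofReal.aemeasurable).trans ?_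
      refine mul_le_mul' (le_of_eq (lintegral_congr fun ω => ?_)) ?_
      · rw [← ENNReal.ofReal_pow (by positivity), mul_pow,
          Real.sq_sqrt (div_pos (hZ0 ω) (hE0 ω)).le, sq_abs]
      · rw [← e1]
        refine le_trans (le_of_eq (lintegral_congr fun ω => ?_))
          (hRi (fun ω => ENNReal.ofReal (V n ω ^ 2)) ((hVm n).pow_const 2).ennreal_ofReal)
        rw [← ENNReal.ofReal_pow (by positivity), mul_pow,
          Real.sq_sqrt (div_pos (hE0 ω) (hZ0 ω)).le, sq_abs,
          ENNReal.ofReal_mul (div_pos (hE0 ω) (hZ0 ω)).le, mul_comm]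
    rcases eq_or_ne v 0 with h0 | h0
    · rw [h0]; exact zero_le
    have hvx : v ≤ C * x := by
      have : v * v ≤ C * x * v := by
        calc v * v = v ^ 2 := (sq v).symm
          _ ≤ x * (C * v) := hv2
          _ = C * x * v := by ring
      exact (ENNReal.mul_le_mul_iff_left h0 hvtop).1 this
    have : v * v ≤ C ^ 3 * w * v := by
      calc v * v ≤ (C * x) * (C * x) := mul_le_mul' hvx hvx
        _ = C ^ 2 * x ^ 2 := by ring
        _ ≤ C ^ 2 * (C * v * w) := by gcongr
        _ = C ^ 3 * w * v := by ring
    exact (ENNReal.mul_le_mul_iff_left h0 hvtop).1 this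
  refine lintegral_le_of_tendsto (f := fun n ω => ENNReal.ofReal (V n ω ^ 2))
    (fun n => ((hV' n).pow_const 2).ennreal_ofReal) (Eventually.of_forall fun ω => ?_) main
    tendsto_const_nhds
  refine tendsto_const_nhds.congr' ?_
  obtain ⟨n₀, hn₀⟩ := exists_nat_ge (E ω)⁻¹
  filter_upwards [eventually_ge_atTop n₀] with n hn
  have : ω ∈ A n := hn₀.trans (by exact_mod_cast hn)
  simp [hV, this]

end ChangeOfMeasure

/-! ### Left limits and compositions with coefficient functions -/

section LeftLimits

variable {T : ℝ} {Ω : Type*}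

lemma IsRCLL.tendsto_leftProcess {E : Type*} [TopologicalSpace E] {X : Time T → Ω → E}
    (hX : IsRCLL X) (t : Time T) (ω : Ω) :
    Tendsto (fun s => X s ω) (𝓝[<] t) (𝓝 (leftProcess X t ω)) :=
  tendsto_leftLim_of_tendsto (hX ω t).2

lemma IsRCLL.sub {X X' : Time T → Ω → ℝ} (hX : IsRCLL X) (hX' : IsRCLL X') :
    IsRCLL fun t ω => X t ω - X' t ω := fun ω t =>
  ⟨(hX ω t).1.sub (hX' ω t).1, by
    obtain ⟨l, hl⟩ := (hX ω t).2
    obtain ⟨l', hl'⟩ := (hX' ω t).2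
    exact ⟨l - l', hl.sub hl'⟩⟩

variable [hT : Fact (0 < T)]

lemma IsRCLL.tendsto_grid {E : Type*} [TopologicalSpace E] {X : Time T → Ω → E}
    (hX : IsRCLL X) {t : Time T} (ht : ⊥ < t) (ω : Ω) :
    Tendsto (fun n => X (grid n (cellIdx n t)) ω) atTop (𝓝 (leftProcess X t ω)) :=
  (hX.tendsto_leftProcess t ω).comp (tendsto_grid_cellIdx ht)

lemma leftProcess_bot {E : Type*} [TopologicalSpace E] (X : Time T → Ω → E) (ω : Ω) :
    leftProcess X ⊥ ω = X ⊥ ω := leftLim_eq_of_isBot isBot_bot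

lemma IsRCLL.measurable_leftProcess {mΩ : MeasurableSpace Ω} {𝓕 : Filtration (Time T) mΩ}
    {E : Type*} [TopologicalSpace E] [TopologicalSpace.PseudoMetrizableSpace E]
    [MeasurableSpace E] [BorelSpace E] {X : Time T → Ω → E} (hX : IsRCLL X)
    (hXm : ∀ t, Measurable[𝓕 t] (X t)) (t : Time T) : Measurable[𝓕 t] (leftProcess X t) := by
  rcases eq_or_lt_of_le (bot_le : ⊥ ≤ t) with rfl | ht
  · have : leftProcess X ⊥ = X ⊥ := funext (leftProcess_bot X)
    rw [this]; exact hXm ⊥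
  · refine @measurable_of_tendsto_metrizable _ _ (𝓕 t) _ _ _ _ _ _
      (fun n => (hXm (grid n (cellIdx n t))).mono (𝓕.mono (mem_cell ht).1.le) le_rfl)
      (tendsto_pi_nhds.2 fun ω => hX.tendsto_grid ht ω)

lemma IsRCLL.abs_leftProcess_le {X : Time T → Ω → ℝ} (hX : IsRCLL X) {ω : Ω} {K : ℝ}
    (hK : ∀ t, |X t ω| ≤ K) (t : Time T) : |(leftProcess X t ω)| ≤ K := by
  rcases eq_or_lt_of_le (bot_le : ⊥ ≤ t) with rfl | ht
  · rw [leftProcess_bot]; exact hK ⊥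
  · exact le_of_tendsto (hX.tendsto_grid ht ω).abs (Eventually.of_forall fun n => hK _)

lemma leftProcess_sub {X X' : Time T → Ω → ℝ} (hX : IsRCLL X) (hX' : IsRCLL X') (t : Time T)
    (ω : Ω) : leftProcess (fun t ω => X t ω - X' t ω) t ω =
      leftProcess X t ω - leftProcess X' t ω := by
  rcases eq_or_lt_of_le (bot_le : ⊥ ≤ t) with rfl | ht
  · simp only [leftProcess_bot]
  · exact tendsto_nhds_unique ((hX.sub hX').tendsto_grid ht ω)
      ((hX.tendsto_grid ht ω).sub (hX'.tendsto_grid ht ω))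

lemma IsSemimartingale.isRCLL {mΩ : MeasurableSpace Ω} {𝓕 : Filtration (Time T) mΩ}
    {P : Measure Ω} {V : Time T → Ω → ℝ} (hV : IsSemimartingale 𝓕 P V) : IsRCLL V := by
  obtain ⟨M, A, hM, hA, hVe⟩ := hV
  intro ω t
  have : (fun s => V s ω) = fun s => M s ω + A s ω := funext fun s => hVe s ω
  rw [this]
  obtain ⟨l, hl⟩ := (hM.1 ω t).2
  obtain ⟨l', hl'⟩ := (hA.1 ω t).2
  exact ⟨(hM.1 ω t).1.add (hA.1 ω t).1, l + l', hl.add hl'⟩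

lemma IsSemimartingale.measurable {mΩ : MeasurableSpace Ω} {𝓕 : Filtration (Time T) mΩ}
    {P : Measure Ω} {V : Time T → Ω → ℝ} (hV : IsSemimartingale 𝓕 P V) (t : Time T) :
    Measurable[𝓕 t] (V t) := by
  obtain ⟨M, A, hM, hA, hVe⟩ := hV
  have : V t = fun ω => M t ω + A t ω := funext fun ω => hVe t ω
  rw [this]
  exact (hM.2.1 t).measurable.add (hA.2.1 t).measurable

end LeftLimits

section Composition

variable {T : ℝ} {m : ℕ} {α : Type*} [TopologicalSpace α]

lemma LeftCts.comp_continuousOn {g : Fin m → α → ℝ} {s : Set α}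
    (hg : ∀ k, ContinuousOn (g k) s) {e : Time T → Fin m} (he : LeftCts e) {q : Time T → α}
    (hq : LeftCts q) (hqs : ∀ u, q u ∈ s) : LeftCts fun u => g (e u) (q u) := by
  intro u
  have h1 : ∀ᶠ v in 𝓝[<] u, e v = e u := by
    have := he u
    rwa [nhds_discrete, tendsto_pure] at this
  have h2 : Tendsto (fun v => g (e u) (q v)) (𝓝[<] u) (𝓝 (g (e u) (q u))) :=
    (hg (e u) (q u) (hqs u)).tendsto.comp
      (tendsto_nhdsWithin_iff.2 ⟨hq u, Eventually.of_forall hqs⟩)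
  refine h2.congr' ?_
  filter_upwards [h1] with v hv
  rw [hv]

lemma LeftCts.prodMk {β : Type*} [TopologicalSpace β] {g : Time T → α} {h : Time T → β}
    (hg : LeftCts g) (hh : LeftCts h) : LeftCts fun u => (g u, h u) := fun u =>
  (hg u).prodMk_nhds (hh u)

lemma LeftCts.mul {g h : Time T → ℝ} (hg : LeftCts g) (hh : LeftCts h) :
    LeftCts fun u => g u * h u := fun u => (hg u).mul (hh u)

lemma measurable_comp_continuousOn [MeasurableSpace α] [BorelSpace α] {Ω : Type*}
    {mΩ : MeasurableSpace Ω} {g : Fin m → α → ℝ} {s : Set α}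
    (hg : ∀ k, ContinuousOn (g k) s) {e : Ω → Fin m} (he : Measurable e) {q : Ω → α}
    (hq : Measurable q) (hqs : ∀ ω, q ω ∈ s) : Measurable fun ω => g (e ω) (q ω) := by
  have h1 : ∀ k, Measurable fun ω => g k (q ω) := fun k =>
    (continuousOn_iff_continuous_domRestrict.1 (hg k)).measurable.comp (hq.subtype_mk (h := hqs))
  have h2 : Measurable fun p : Fin m × Ω => g p.1 (q p.2) :=
    measurable_from_prod_countable_right h1
  exact h2.comp (he.prodMk measurable_id)

end Composition

/-! ### The market price of risk and the density of the minimal measure -/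

section Model

variable {T : ℝ} {Ω : Type*} {mΩ : MeasurableSpace Ω} {d r m : ℕ}
  {D : Set (EuclideanSpace ℝ (Fin d))} {c : Coefficients d r m} {Y : Processes T Ω d r m}
  {𝓕 : Filtration (Time T) mΩ} {P : Measure Ω}

lemma Coefficients.Admissible.continuousOn_Φ (hc : c.Admissible T D) (k : Fin m) (j : Fin r) :
    ContinuousOn (fun p : ℝ × EuclideanSpace ℝ (Fin d) => c.Φ p.1 p.2 k j)
      (Set.Icc 0 T ×ˢ D) := by
  rw [continuousOn_iff_continuous_domRestrict]
  set s : Set (ℝ × EuclideanSpace ℝ (Fin d)) := Set.Icc 0 T ×ˢ D with hs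
  have hΓ : Continuous fun p : s => c.Γ p.1.1 p.1.2 k := continuous_pi fun i =>
    continuousOn_iff_continuous_domRestrict.1 (hc.drift_C1 k i).continuousOn
  have hvol : Continuous fun p : s => c.vol p.1.1 p.1.2 k := continuous_matrix fun i j =>
    continuousOn_iff_continuous_domRestrict.1 (hc.vol_C1 k i j).continuousOn
  have hA : Continuous fun p : s => c.vol p.1.1 p.1.2 k * (c.vol p.1.1 p.1.2 k).transpose :=
    hvol.matrix_mul hvol.matrix_transpose
  have hinv : Continuous fun p : s =>
      (c.vol p.1.1 p.1.2 k * (c.vol p.1.1 p.1.2 k).transpose)⁻¹ := by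
    simp_rw [Matrix.inv_def, Ring.inverse_eq_inv']
    refine Continuous.smul (hA.matrix_det.inv₀ fun p => ?_) hA.matrix_adjugate
    exact (hc.risk_exists k p.1.1 p.2.1 p.1.2 p.2.2).ne_zero
  exact (continuous_apply j).comp (hvol.matrix_transpose.matrix_mulVec (hinv.matrix_mulVec hΓ))

variable [hT : Fact (0 < T)]

lemma IsModel.hasIncrementBound [IsProbabilityMeasure P] (hY : IsModel D c Y 𝓕 P)
    (hc : c.Admissible T D) : ∃ C, HasIncrementBound 𝓕 P Y.N C := by
  obtain ⟨C, hC⟩ := hc.lam_bdd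
  refine ⟨max C 0, le_max_right _ _, hY.point.adapted, fun k j s t hst ζ hζ => ?_⟩
  have hm1 := (hY.point.adapted k j t).mono (𝓕.le t) le_rfl
  have hm2 := (hY.point.adapted k j s).mono (𝓕.le s) le_rfl
  have h3 : Measurable fun p : ℕ × ℕ => ((p.1 - p.2 : ℕ) : ENNReal) := .of_discrete
  refine lintegral_mul_le_of_setLIntegral_le (𝓕.le s) (h3.comp (hm1.prodMk hm2))
    (fun A hA => ?_) hζ
  refine setLIntegral_increment_le (l := fun u ω => c.lam k j u (Y.S u ω))
    (hY.point.adapted k j) (hY.point.mono k j) (fun ω => ?_)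
    (fun u ω => hc.lam_nonneg k j u u.2 _ (hY.S_mem u ω))
    (fun u ω => (hC k j u u.2 _ (hY.S_mem u ω)).trans (le_max_left _ _))
    (hY.intensity k j) hst hA
  exact (hc.lam_C1 k j).continuousOn.comp_continuous
    (f := fun u : Time T => ((u : ℝ), Y.S u ω))
    (continuous_subtype_val.prodMk (hY.S_continuous ω)) fun u => ⟨u.2, hY.S_mem u ω⟩

/-- Both `P` and the minimal measure have a positive square-integrable density `Z` that, at every
time `t`, factors into an `𝓕 t`-measurable factor `E` and a factor `R` such that `R²` and `R⁻¹`
have bounded conditional expectation given `𝓕 t`, uniformly in `t`. -/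
lemma IsModel.exists_density [IsProbabilityMeasure P] (hY : IsModel D c Y 𝓕 P)
    (hc : c.Admissible T D) {Q : Measure Ω} (hQ : Q = P ∨ IsMinimalMeasure c Y 𝓕 P Q) :
    ∃ Z : Ω → ℝ, Measurable Z ∧ (∀ ω, 0 < Z ω) ∧ ∫⁻ ω, ENNReal.ofReal (Z ω ^ 2) ∂P ≠ ⊤ ∧
      Q = P.withDensity (fun ω => ENNReal.ofReal (Z ω)) ∧
      ∃ C : NNReal, ∀ t : Time T, ∃ E : Ω → ℝ, Measurable[𝓕 t] E ∧ (∀ ω, 0 < E ω) ∧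
        (∀ ζ : Ω → ENNReal, Measurable[𝓕 t] ζ →
          ∫⁻ ω, ζ ω * ENNReal.ofReal ((Z ω / E ω) ^ 2) ∂P ≤ C * ∫⁻ ω, ζ ω ∂P) ∧
        (∀ ζ : Ω → ENNReal, Measurable[𝓕 t] ζ →
          ∫⁻ ω, ζ ω * ENNReal.ofReal (E ω / Z ω) ∂P ≤ C * ∫⁻ ω, ζ ω ∂P) := by
  rcases hQ with rfl | ⟨X, hX, hQ⟩
  · refine ⟨fun _ => 1, measurable_const, fun _ => one_pos, by simp, ?_, 1, fun t =>
      ⟨fun _ => 1, measurable_const, fun _ => one_pos, ?_, ?_⟩⟩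
    · simp only [ENNReal.ofReal_one]
      exact withDensity_one.symm
    · intro ζ _; simp
    · intro ζ _; simp
  obtain ⟨C₀, hC₀⟩ := hc.risk_bdd
  have hηm : ∀ t, Measurable[𝓕 t] (leftProcess Y.η t) := fun t =>
    hY.η_rcll.measurable_leftProcess hY.η_adapted t
  have hSm : ∀ t, Measurable[𝓕 t] (Y.S t) := fun t => (hY.S_adapted t).measurable
  set H : Time T → Ω → Fin r → ℝ := fun t ω j => -c.Φ t (Y.S t ω) (leftProcess Y.η t ω) j with hH
  have hHm : ∀ t, Measurable[𝓕 t] (H t) := fun t => by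
    refine @measurable_pi_lambda _ _ _ (𝓕 t) _ _ fun j => Measurable.neg ?_
    exact measurable_comp_continuousOn
      (g := fun k x => c.Φ t x k j) (s := D)
      (fun k => (hc.continuousOn_Φ k j).comp (f := fun x => ((t : ℝ), x)) (by fun_prop)
        fun x hx => ⟨t.2, hx⟩)
      (hηm t) (hSm t) (hY.S_mem t)
  set b : ℝ := r * C₀ ^ 2 with hb
  have hb0 : 0 ≤ b := by positivity
  have hΦb : ∀ (t : Time T) ω, ∑ j, c.Φ t (Y.S t ω) (leftProcess Y.η t ω) j ^ 2 ≤ b := by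
    intro t ω
    calc ∑ j, c.Φ t (Y.S t ω) (leftProcess Y.η t ω) j ^ 2 ≤ ∑ j : Fin r, C₀ ^ 2 := by
          refine Finset.sum_le_sum fun j _ => ?_
          rw [← sq_abs]
          exact pow_le_pow_left₀ (abs_nonneg _) (hC₀ _ t t.2 _ (hY.S_mem t ω) j) 2
      _ = b := by simp [hb]
  have hHb : ∀ t ω, ∑ j, H t ω j ^ 2 ≤ b := fun t ω => by
    simp only [hH, neg_sq]; exact hΦb t ω
  set I : Ω → ℝ := fun ω =>
    ∫ u : Time T, ∑ j : Fin r, c.Φ u (Y.S u ω) (leftProcess Y.η u ω) j ^ 2 with hI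
  have hI0 : ∀ ω, 0 ≤ I ω := fun ω =>
    integral_nonneg fun u => Finset.sum_nonneg fun j _ => sq_nonneg _
  have hIb : ∀ ω, I ω ≤ b * T := by
    intro ω
    have h := norm_setIntegral_le_of_norm_le_const (μ := (volume : Measure (Time T)))
      (s := Set.Iic (⊤ : Time T)) (C := b)
      (f := fun u : Time T => ∑ j : Fin r, c.Φ u (Y.S u ω) (leftProcess Y.η u ω) j ^ 2)
      (measure_lt_top _ _) (fun u _ => by
        rw [Real.norm_of_nonneg (Finset.sum_nonneg fun j _ => sq_nonneg _)]; exact hΦb u ω)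
    rw [Set.Iic_top, setIntegral_univ] at h
    refine (le_abs_self _).trans (h.trans ?_)
    exact mul_le_mul_of_nonneg_left (by simpa using time_volume_real_Iic_le (⊤ : Time T)) hb0
  have hIm : Measurable I := by
    refine measurable_of_tendsto_metrizable (f := fun n ω => ∑ i ∈ Finset.range (n + 1),
      (∑ j : Fin r, c.Φ (grid n i : Time T) (Y.S (grid n i) ω) (leftProcess Y.η (grid n i) ω) j ^ 2)
        * (T / (n + 1))) (fun n => ?_) (tendsto_pi_nhds.2 fun ω => ?_)
    · refine Finset.measurable_sum _ fun i _ => (Finset.measurable_sum _ fun j _ => ?_).mul_const _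
      have h1 := (measurable_pi_apply j).comp ((hHm (grid n i)).mono (𝓕.le _) le_rfl)
      have h2 := h1.pow_const 2
      simpa [hH, Function.comp_def] using h2
    · have hl : LeftCts fun u : Time T =>
          ∑ j : Fin r, c.Φ u (Y.S u ω) (leftProcess Y.η u ω) j ^ 2 := fun u => by
        refine tendsto_finsetSum _ fun j _ => Tendsto.pow ?_ 2
        exact LeftCts.comp_continuousOn (g := fun k (q : ℝ × EuclideanSpace ℝ (Fin d)) =>
          c.Φ q.1 q.2 k j) (fun k => hc.continuousOn_Φ k j) (hY.η_rcll.leftCts ω)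
          (q := fun u : Time T => ((u : ℝ), Y.S u ω))
          (continuous_subtype_val.prodMk (hY.S_continuous ω)).leftCts
          (fun u => ⟨u.2, hY.S_mem u ω⟩) u
      exact (hl.integrable_and_tendsto (C := b) fun u => by
        rw [abs_of_nonneg (Finset.sum_nonneg fun j _ => sq_nonneg _)]; exact hΦb u ω).2
  have hXm : ∀ t, Measurable[𝓕 t] (X t) := fun t => (hX.adapted t).measurable
  have hXm' : ∀ t, Measurable (X t) := fun t => (hXm t).mono (𝓕.le t) le_rfl
  have hmom := fun a t ζ => hX.lintegral_mul_exp_le hY.brownian hHm hHb a t (ζ := ζ)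
  set Z : Ω → ℝ := fun ω => Real.exp (X ⊤ ω - 1 / 2 * I ω) with hZ
  have hZm : Measurable Z := Real.measurable_exp.comp ((hXm' ⊤).sub (hIm.const_mul _))
  refine ⟨Z, hZm, fun ω => Real.exp_pos _, ?_, hQ,
    Real.toNNReal (Real.exp (T * (2 ^ 2 * b) / 2)) +
      Real.toNNReal (Real.exp (b * T / 2)) * Real.toNNReal (Real.exp (T * ((-1) ^ 2 * b) / 2)),
    fun t => ⟨fun ω => Real.exp (X t ω), Real.measurable_exp.comp (hXm t),
      fun ω => Real.exp_pos _, fun ζ hζ => ?_, fun ζ hζ => ?_⟩⟩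
  · refine ne_top_of_le_ne_top ?_ (le_trans (lintegral_mono_ae ?_)
      (hmom 2 ⊥ (fun _ => 1) measurable_const))
    · simp [ENNReal.ofReal_ne_top]
    · filter_upwards [hX.ae_bot_eq_zero] with ω hω
      rw [one_mul, hω, hZ, ← Real.exp_nat_mul]
      refine ENNReal.ofReal_le_ofReal (Real.exp_le_exp.2 ?_)
      have := hI0 ω
      push_cast; linarith
  · refine le_trans (lintegral_mono fun ω => ?_) ((hmom 2 t ζ hζ).trans ?_)
    · simp only [hZ]
      rw [← Real.exp_sub, ← Real.exp_nat_mul]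
      refine mul_le_mul_right (ENNReal.ofReal_le_ofReal (Real.exp_le_exp.2 ?_)) _
      have := hI0 ω
      push_cast; linarith
    · gcongr
      rw [ENNReal.coe_add]
      exact le_self_add
  · have h1 : ∀ ω, ζ ω * ENNReal.ofReal (Real.exp (X t ω) / Z ω) ≤
        ENNReal.ofReal (Real.exp (b * T / 2)) *
          (ζ ω * ENNReal.ofReal (Real.exp (-1 * (X ⊤ ω - X t ω)))) := by
      intro ω
      simp only [hZ]
      rw [← Real.exp_sub, mul_left_comm, ← ENNReal.ofReal_mul (Real.exp_pos _).le, ← Real.exp_add]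
      gcongr
      have := hIb ω
      linarith
    refine (lintegral_mono h1).trans ?_
    rw [lintegral_const_mul' _ _ ENNReal.ofReal_ne_top]
    refine (mul_le_mul_right (hmom (-1) t ζ hζ) _).trans ?_
    rw [← mul_assoc]
    gcongr
    rw [ENNReal.coe_add, ENNReal.coe_mul]
    exact le_add_self

end Model

/-! ### Payment rates of the recursive equation -/

section Rates

variable {T : ℝ} [hT : Fact (0 < T)] {Ω : Type*} {mΩ : MeasurableSpace Ω} {d r m : ℕ}
  {D : Set (EuclideanSpace ℝ (Fin d))} {c : Coefficients d r m} {Y : Processes T Ω d r m}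
  {𝓕 : Filtration (Time T) mΩ} {P : Measure Ω} {p : Payoff d m}

/-- The rate `1_{u > t} δ(u, S_u, η_{u-}, V_{u-})` of continuous payments. -/
noncomputable def flowRate (Y : Processes T Ω d r m) (p : Payoff d m) (V : Time T → Ω → ℝ)
    (t u : Time T) (ω : Ω) : ℝ :=
  (Set.Ioi t).indicator 1 u * p.δ u (Y.S u ω) (leftProcess Y.η u ω) (leftProcess V u ω)

/-- The payment `1_{u > t} 1_{k ≠ j} f^{kj}(u, S_u, V_{u-}) 1_{η_{u-} = k}` at a jump of
`N^{kj}`. -/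
noncomputable def jumpRate (Y : Processes T Ω d r m) (p : Payoff d m) (V : Time T → Ω → ℝ)
    (t : Time T) (k j : Fin m) (u : Time T) (ω : Ω) : ℝ :=
  (Set.Ioi t).indicator 1 u * ((if j ≠ k then 1 else 0) *
    (p.f k j u (Y.S u ω) (leftProcess V u ω) * (if leftProcess Y.η u ω = k then 1 else 0)))

lemma futurePayments_eq (Y : Processes T Ω d r m) (p : Payoff d m) (V : Time T → Ω → ℝ)
    (t : Time T) (ω : Ω) : futurePayments Y p V t ω = p.h (Y.S ⊤ ω) (Y.η ⊤ ω) +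
      ((∫ u, flowRate Y p V t u ω) + ∑ k, ∑ j,
        jumpIntegral (fun u => jumpRate Y p V t k j u ω) (fun u => Y.N k j u ω) Set.univ) := by
  unfold futurePayments
  rw [add_assoc]
  congr 2
  · rw [← integral_indicator measurableSet_Ioi]
    congr 1
    ext u
    by_cases h : u ∈ Set.Ioi t
    · simp [flowRate, h]
    · simp [flowRate, h]
  · refine Finset.sum_congr rfl fun k _ => ?_
    rw [Finset.sum_filter]
    refine Finset.sum_congr rfl fun j _ => ?_
    by_cases hjk : j ≠ k
    · rw [if_pos hjk]
      unfold jumpIntegral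
      rw [finsum_mem_univ, finsum_mem_def]
      congr 1
      ext u
      by_cases h : u ∈ Set.Ioi t
      · simp [jumpRate, h, hjk]
      · simp [jumpRate, h]
    · rw [if_neg hjk]
      simp [jumpIntegral, jumpRate, hjk]

lemma leftCts_flowRate (hY : IsModel D c Y 𝓕 P) (hp : p.Admissible T D) {V : Time T → Ω → ℝ}
    (hV : IsRCLL V) (t : Time T) (ω : Ω) : LeftCts fun u => flowRate Y p V t u ω :=
  (leftCts_indicator_Ioi t).mul (LeftCts.comp_continuousOn
    (g := fun k (q : ℝ × EuclideanSpace ℝ (Fin d) × ℝ) => p.δ q.1 q.2.1 k q.2.2)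
    (fun k => (hp.δ_C1 k).continuousOn) (hY.η_rcll.leftCts ω)
    (q := fun u : Time T => ((u : ℝ), Y.S u ω, leftProcess V u ω))
    (continuous_subtype_val.leftCts.prodMk ((hY.S_continuous ω).leftCts.prodMk (hV.leftCts ω)))
    fun u => ⟨u.2, hY.S_mem u ω, Set.mem_univ _⟩)

lemma leftCts_jumpRate (hY : IsModel D c Y 𝓕 P) (hp : p.Admissible T D) {V : Time T → Ω → ℝ}
    (hV : IsRCLL V) (t : Time T) (k j : Fin m) (ω : Ω) :
    LeftCts fun u => jumpRate Y p V t k j u ω :=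
  (leftCts_indicator_Ioi t).mul (continuous_const.leftCts.mul (LeftCts.comp_continuousOn
    (g := fun l (q : ℝ × EuclideanSpace ℝ (Fin d) × ℝ) =>
      p.f k j q.1 q.2.1 q.2.2 * (if l = k then 1 else 0))
    (fun _ => (hp.f_C1 k j).continuousOn.mul continuousOn_const) (hY.η_rcll.leftCts ω)
    (q := fun u : Time T => ((u : ℝ), Y.S u ω, leftProcess V u ω))
    (continuous_subtype_val.leftCts.prodMk ((hY.S_continuous ω).leftCts.prodMk (hV.leftCts ω)))
    fun u => ⟨u.2, hY.S_mem u ω, Set.mem_univ _⟩))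

lemma measurable_rates (hY : IsModel D c Y 𝓕 P) (hp : p.Admissible T D) {V : Time T → Ω → ℝ}
    (hV : IsRCLL V) (hVm : ∀ t, Measurable[𝓕 t] (V t)) (t u : Time T) :
    Measurable (flowRate Y p V t u) ∧ ∀ k j, Measurable (jumpRate Y p V t k j u) := by
  have hη : Measurable (leftProcess Y.η u) :=
    (hY.η_rcll.measurable_leftProcess hY.η_adapted u).mono (𝓕.le u) le_rfl
  have hl : Measurable (leftProcess V u) :=
    (hV.measurable_leftProcess hVm u).mono (𝓕.le u) le_rfl
  have hS : Measurable (Y.S u) := ((hY.S_adapted u).mono (𝓕.le u)).measurable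
  have hq : Measurable fun ω => ((u : ℝ), Y.S u ω, leftProcess V u ω) :=
    measurable_const.prodMk (hS.prodMk hl)
  refine ⟨Measurable.const_mul ?_ _, fun k j => Measurable.const_mul (Measurable.const_mul ?_ _) _⟩
  · exact measurable_comp_continuousOn
      (g := fun k (q : ℝ × EuclideanSpace ℝ (Fin d) × ℝ) => p.δ q.1 q.2.1 k q.2.2)
      (fun k => (hp.δ_C1 k).continuousOn) hη hq fun ω => ⟨u.2, hY.S_mem u ω, Set.mem_univ _⟩
  · exact measurable_comp_continuousOn
      (g := fun l (q : ℝ × EuclideanSpace ℝ (Fin d) × ℝ) =>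
        p.f k j q.1 q.2.1 q.2.2 * (if l = k then 1 else 0))
      (fun _ => (hp.f_C1 k j).continuousOn.mul continuousOn_const) hη hq
      fun ω => ⟨u.2, hY.S_mem u ω, Set.mem_univ _⟩

lemma abs_jump_factor_le (k j l : Fin m) (x : ℝ) :
    |(if j ≠ k then (1 : ℝ) else 0) * (x * (if l = k then 1 else 0))| ≤ |x| := by
  split_ifs <;> simp

lemma exists_rate_bound (hY : IsModel D c Y 𝓕 P) (hp : p.Admissible T D) (K : ℝ) :
    ∃ B : ℝ, ∀ V : Time T → Ω → ℝ, ∀ t u ω, |(leftProcess V u ω)| ≤ K →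
      |flowRate Y p V t u ω| ≤ B ∧ ∀ k j, |jumpRate Y p V t k j u ω| ≤ B := by
  obtain ⟨K₀, hK₀⟩ := hp.growth
  refine ⟨|K₀| * (1 + K), fun V t u ω hV => ?_⟩
  have hle : K₀ * (1 + |(leftProcess V u ω)|) ≤ |K₀| * (1 + K) := by
    gcongr
    exact le_abs_self _
  have hind : |(Set.Ioi t).indicator (1 : Time T → ℝ) u| ≤ 1 := by
    by_cases h : u ∈ Set.Ioi t <;> simp [h]
  have key : ∀ x : ℝ, |x| ≤ |K₀| * (1 + K) →
      |(Set.Ioi t).indicator (1 : Time T → ℝ) u * x| ≤ |K₀| * (1 + K) := by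
    intro x hx
    rw [abs_mul]
    exact (mul_le_of_le_one_left (abs_nonneg _) hind).trans hx
  obtain ⟨h1, h2⟩ := hK₀ u u.2 (Y.S u ω) (hY.S_mem u ω) (leftProcess V u ω)
  exact ⟨key _ ((h1 _).trans hle), fun k j =>
    key _ ((abs_jump_factor_le _ _ _ _).trans ((h2 k j).trans hle))⟩

lemma exists_rate_lipschitz (hY : IsModel D c Y 𝓕 P) (hp : p.Admissible T D) (K : ℝ) :
    ∃ L : ℝ, 0 ≤ L ∧ ∀ V V' : Time T → Ω → ℝ, ∀ t u ω, |(leftProcess V u ω)| ≤ K →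
      |(leftProcess V' u ω)| ≤ K →
      |flowRate Y p V t u ω - flowRate Y p V' t u ω| ≤
        (Set.Ioi t).indicator 1 u * (L * |(leftProcess V u ω - leftProcess V' u ω)|) ∧
      ∀ k j, |jumpRate Y p V t k j u ω - jumpRate Y p V' t k j u ω| ≤
        (Set.Ioi t).indicator 1 u * (L * |(leftProcess V u ω - leftProcess V' u ω)|) := by
  choose L₁ hL₁ using fun k => hp.δ_lip k K
  choose L₂ hL₂ using fun k j => hp.f_lip k j K
  obtain ⟨M₁, hM₁⟩ := Finite.exists_le L₁
  obtain ⟨M₂, hM₂⟩ := Finite.exists_le fun q : Fin m × Fin m => L₂ q.1 q.2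
  refine ⟨max (max M₁ M₂) 0, le_max_right _ _, fun V V' t u ω hV hV' => ?_⟩
  have hind : 0 ≤ (Set.Ioi t).indicator (1 : Time T → ℝ) u :=
    Set.indicator_nonneg (fun _ _ => zero_le_one) u
  constructor
  · rw [flowRate, flowRate, ← mul_sub, abs_mul, abs_of_nonneg hind]
    gcongr
    refine (hL₁ _ u u.2 _ (hY.S_mem u ω) _ _ hV hV').trans ?_
    gcongr
    exact (hM₁ _).trans ((le_max_left _ _).trans (le_max_left _ _))
  · intro k j
    rw [jumpRate, jumpRate, ← mul_sub, abs_mul, abs_of_nonneg hind, ← mul_sub, ← sub_mul]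
    gcongr
    refine (abs_jump_factor_le _ _ _ _).trans
      ((hL₂ k j u u.2 _ (hY.S_mem u ω) _ _ hV hV').trans ?_)
    gcongr
    exact (hM₂ (k, j)).trans ((le_max_right _ _).trans (le_max_left _ _))

lemma paymentSum_sub (N : Fin m → Fin m → Time T → Ω → ℕ) (a a' : Time T → Ω → ℝ)
    (b b' : Fin m → Fin m → Time T → Ω → ℝ) (n : ℕ) (ω : Ω) :
    paymentSum N a b n ω - paymentSum N a' b' n ω =
      paymentSum N (fun u ω => a u ω - a' u ω) (fun k j u ω => b k j u ω - b' k j u ω) n ω := by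
  unfold paymentSum
  rw [← Finset.sum_sub_distrib]
  refine Finset.sum_congr rfl fun i _ => ?_
  simp only [sub_mul, Finset.sum_sub_distrib]
  ring

end Rates

/-! ### Integrability and comparison of future payments -/

section Payments

variable {T : ℝ} [hT : Fact (0 < T)] {Ω : Type*} {mΩ : MeasurableSpace Ω} {d r m : ℕ}
  {D : Set (EuclideanSpace ℝ (Fin d))} {c : Coefficients d r m} {Y : Processes T Ω d r m}
  {𝓕 : Filtration (Time T) mΩ} {P : Measure Ω} {p : Payoff d m}

lemma tendsto_paymentSum_rates (hY : IsModel D c Y 𝓕 P) (hp : p.Admissible T D)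
    {V : Time T → Ω → ℝ} (hV : IsRCLL V) (t : Time T) {ω : Ω} {K : ℝ}
    (hK : ∀ u, |V u ω| ≤ K) :
    Tendsto (fun n => paymentSum Y.N (flowRate Y p V t) (jumpRate Y p V t) n ω) atTop
      (𝓝 (futurePayments Y p V t ω - p.h (Y.S ⊤ ω) (Y.η ⊤ ω))) := by
  obtain ⟨B, hB⟩ := exists_rate_bound hY hp K
  rw [futurePayments_eq, add_sub_cancel_left]
  exact tendsto_paymentSum hY.point (leftCts_flowRate hY hp hV t ω)
    (fun u => (hB V t u ω (hV.abs_leftProcess_le hK u)).1)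
    fun k j => leftCts_jumpRate hY hp hV t k j ω

lemma measurable_terminal (hY : IsModel D c Y 𝓕 P) (hp : p.Admissible T D) :
    Measurable fun ω => p.h (Y.S ⊤ ω) (Y.η ⊤ ω) :=
  measurable_comp_continuousOn (g := fun k x => p.h x k) hp.h_cont
    ((hY.η_adapted ⊤).mono (𝓕.le _) le_rfl) ((hY.S_adapted ⊤).mono (𝓕.le _)).measurable
    (hY.S_mem ⊤)

lemma aemeasurable_futurePayments (hY : IsModel D c Y 𝓕 P) (hp : p.Admissible T D)
    {V : Time T → Ω → ℝ} (hV : IsRCLL V) (hVm : ∀ t, Measurable[𝓕 t] (V t))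
    (hVb : IsBoundedProcess P V) (t : Time T) : AEMeasurable (futurePayments Y p V t) P := by
  obtain ⟨K, hK⟩ := hVb
  have h : AEMeasurable
      (fun ω => futurePayments Y p V t ω - p.h (Y.S ⊤ ω) (Y.η ⊤ ω)) P := by
    refine aemeasurable_of_tendsto_metrizable_ae atTop (fun n => (measurable_paymentSum
      (𝓕 := 𝓕) hY.point.adapted (fun u => (measurable_rates hY hp hV hVm t u).1)
      (fun k j u => (measurable_rates hY hp hV hVm t u).2 k j) n).aemeasurable) ?_
    filter_upwards [hK] with ω hω
    exact tendsto_paymentSum_rates hY hp hV t hω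
  have h2 := h.add (measurable_terminal hY hp).aemeasurable
  refine h2.congr (Eventually.of_forall fun ω => ?_)
  simp

lemma integrable_futurePayments [IsProbabilityMeasure P] (hY : IsModel D c Y 𝓕 P)
    (hc : c.Admissible T D) (hp : p.Admissible T D) {V : Time T → Ω → ℝ} (hV : IsRCLL V)
    (hVm : ∀ t, Measurable[𝓕 t] (V t)) (hVb : IsBoundedProcess P V) {Z : Ω → ℝ}
    (hZ : Measurable Z) (hZ2 : ∫⁻ ω, ENNReal.ofReal (Z ω ^ 2) ∂P ≠ ⊤)
    (t : Time T) :
    Integrable (futurePayments Y p V t) (P.withDensity fun ω => ENNReal.ofReal (Z ω)) := by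
  have hG := aemeasurable_futurePayments hY hp hV hVm hVb t
  obtain ⟨K, hK⟩ := hVb
  obtain ⟨B, hB⟩ := exists_rate_bound hY hp K
  obtain ⟨C, hN⟩ := hY.hasIncrementBound hc
  obtain ⟨M, hM⟩ := hN.lintegral_sq_paymentSum_le
  have hm := measurable_terminal hY hp
  have h1 : Integrable (fun ω => futurePayments Y p V t ω - p.h (Y.S ⊤ ω) (Y.η ⊤ ω))
      (P.withDensity fun ω => ENNReal.ofReal (Z ω)) := by
    refine integrable_withDensity_of_sq hZ hZ2 (hG.sub hm.aemeasurable) ?_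
    refine ne_top_of_le_ne_top ?_ (lintegral_le_of_tendsto (fun n => ((measurable_paymentSum
      (𝓕 := 𝓕) hY.point.adapted (fun u => (measurable_rates hY hp hV hVm t u).1)
      (fun k j u => (measurable_rates hY hp hV hVm t u).2 k j) n).pow_const 2).ennreal_ofReal)
      (c' := M * (ENNReal.ofReal T * ENNReal.ofReal (B ^ 2))) ?_ (fun n => ?_)
      tendsto_const_nhds)
    · exact ENNReal.mul_ne_top ENNReal.coe_ne_top
        (ENNReal.mul_ne_top ENNReal.ofReal_ne_top ENNReal.ofReal_ne_top)
    · filter_upwards [hK] with ω hω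
      exact ENNReal.tendsto_ofReal ((tendsto_paymentSum_rates hY hp hV t hω).pow 2)
    · refine (hM _ _ (fun _ _ => B) (fun _ => measurable_const) ?_ n).trans (le_of_eq ?_)
      · filter_upwards [hK] with ω hω u
        exact hB V t u ω (hV.abs_leftProcess_le hω u)
      · have hn : (0 : ℝ) < n + 1 := by positivity
        have : ((n : ENNReal) + 1) = ENNReal.ofReal ((n : ℝ) + 1) := by
          rw [ENNReal.ofReal_add (by positivity) zero_le_one]; simp
        simp only [lintegral_const, measure_univ, mul_one, Finset.sum_const, Finset.card_range,
          nsmul_eq_mul]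
        push_cast
        rw [this, ← mul_assoc (ENNReal.ofReal ((n : ℝ) + 1)), ← ENNReal.ofReal_mul hn.le,
          mul_div_cancel₀ _ hn.ne']
  obtain ⟨Ch, hCh⟩ := hp.h_bdd
  have h2 : Integrable (fun ω => p.h (Y.S ⊤ ω) (Y.η ⊤ ω))
      (P.withDensity fun ω => ENNReal.ofReal (Z ω)) := by
    refine integrable_withDensity_of_sq hZ hZ2 hm.aemeasurable
      (ne_top_of_le_ne_top ?_ (lintegral_mono (g := fun _ => ENNReal.ofReal (Ch ^ 2))
        fun ω => ?_))
    · simp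
    · refine ENNReal.ofReal_le_ofReal ?_
      rw [← sq_abs]
      exact pow_le_pow_left₀ (abs_nonneg _) (hCh _ _ (hY.S_mem _ _)) 2
  refine (h1.add h2).congr (Eventually.of_forall fun ω => ?_)
  simp

/-- A left Riemann sum of `e^{-βs}` over the grid points after `t`. -/
lemma sum_grid_exp_le {β : ℝ} (hβ : 0 < β) (t : Time T) (n : ℕ) :
    ∑ i ∈ Finset.range (n + 1), T / (n + 1) *
      ((Set.Ioi t).indicator 1 (grid n i) * Real.exp (-(β * (grid n i : Time T)))) ≤
      Real.exp (-(β * ((t : ℝ) - T / (n + 1)))) / β := by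
  have h0 := hT.out
  set Δ : ℝ := T / (n + 1) with hΔ
  have hΔ0 : 0 < Δ := by positivity
  set q : ℕ → ℝ := fun i =>
    min (Real.exp (-(β * (i * Δ - Δ)))) (Real.exp (-(β * ((t : ℝ) - Δ)))) with hq
  have hterm : ∀ i ∈ Finset.range (n + 1), Δ *
      ((Set.Ioi t).indicator 1 (grid n i) * Real.exp (-(β * (grid n i : Time T)))) ≤
      (q i - q (i + 1)) / β := by
    intro i hi
    have hg : ((grid n i : Time T) : ℝ) = i * Δ := by
      rw [grid_coe (Finset.mem_range.1 hi).le, hΔ]; ring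
    rw [le_div_iff₀ hβ]
    have hq1 : q (i + 1) = min (Real.exp (-(β * (i * Δ)))) (Real.exp (-(β * ((t : ℝ) - Δ)))) := by
      simp only [hq]; congr 3; push_cast; ring
    by_cases h : t < grid n i
    · have h' : (t : ℝ) < i * Δ := by rw [← hg]; exact h
      rw [Set.indicator_of_mem (show grid n i ∈ Set.Ioi t from h), hq1, hq, hg]
      simp only [Pi.one_apply]
      rw [min_eq_left (Real.exp_le_exp.2 (by nlinarith)),
        min_eq_left (Real.exp_le_exp.2 (by nlinarith))]
      have h1 : Real.exp (-(β * (i * Δ - Δ))) =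
          Real.exp (-(β * (i * Δ))) * Real.exp (β * Δ) := by
        rw [← Real.exp_add]; congr 1; ring
      have h2 := Real.add_one_le_exp (β * Δ)
      have h3 := Real.exp_pos (-(β * (i * Δ)))
      rw [h1]
      nlinarith
    · rw [Set.indicator_of_notMem (show grid n i ∉ Set.Ioi t from h), hq1]
      simp only [zero_mul, mul_zero, sub_nonneg, hq]
      refine min_le_min_right _ (Real.exp_le_exp.2 ?_)
      nlinarith
  refine (Finset.sum_le_sum hterm).trans ?_
  rw [← Finset.sum_div, Finset.sum_range_sub']
  gcongr
  have h1 : 0 ≤ q (n + 1) := le_min (Real.exp_pos _).le (Real.exp_pos _).le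
  have h2 : q 0 ≤ Real.exp (-(β * ((t : ℝ) - Δ))) := min_le_right _ _
  linarith

/-- The second moment of the difference of the future payments for two value processes, in terms
of an exponential bound on the second moment of the difference of their left limits. -/
lemma exists_lintegral_sq_futurePayments_sub_le [IsProbabilityMeasure P]
    (hY : IsModel D c Y 𝓕 P) (hc : c.Admissible T D) (hp : p.Admissible T D)
    {V V' : Time T → Ω → ℝ} (hV : IsRCLL V) (hVm : ∀ t, Measurable[𝓕 t] (V t))
    (hVb : IsBoundedProcess P V) (hV' : IsRCLL V') (hVm' : ∀ t, Measurable[𝓕 t] (V' t))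
    (hVb' : IsBoundedProcess P V') :
    ∃ M : NNReal, ∀ β > 0, ∀ B ≥ 0,
      (∀ s : Time T, ∫⁻ ω, ENNReal.ofReal ((leftProcess V s ω - leftProcess V' s ω) ^ 2) ∂P ≤
        ENNReal.ofReal (B * Real.exp (-(β * s)))) →
      ∀ t : Time T, ∫⁻ ω, ENNReal.ofReal
        ((futurePayments Y p V t ω - futurePayments Y p V' t ω) ^ 2) ∂P ≤
        M * ENNReal.ofReal (B * (Real.exp (-(β * t)) / β)) := by
  have h0 := hT.out
  obtain ⟨K, hK⟩ := hVb
  obtain ⟨K', hK'⟩ := hVb'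
  obtain ⟨L, hL0, hL⟩ := exists_rate_lipschitz hY hp (max K K')
  obtain ⟨C, hN⟩ := hY.hasIncrementBound hc
  obtain ⟨M, hM⟩ := hN.lintegral_sq_paymentSum_le
  refine ⟨M * Real.toNNReal (L ^ 2), fun β hβ B hB hψ t => ?_⟩
  have hbd : ∀ᵐ ω ∂P, (∀ u, |V u ω| ≤ max K K') ∧ ∀ u, |V' u ω| ≤ max K K' := by
    filter_upwards [hK, hK'] with ω h h'
    exact ⟨fun u => (h u).trans (le_max_left _ _), fun u => (h' u).trans (le_max_right _ _)⟩
  set H : Time T → Ω → ℝ := fun u ω =>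
    (Set.Ioi t).indicator 1 u * (L * |(leftProcess V u ω - leftProcess V' u ω)|) with hH
  have hHm : ∀ u, Measurable[𝓕 u] (H u) := fun u => ((continuous_abs.measurable.comp
    ((hV.measurable_leftProcess hVm u).sub (hV'.measurable_leftProcess hVm' u))).const_mul
      L).const_mul _
  have hmeas := fun n => (measurable_paymentSum (n := n)
      (𝓕 := 𝓕) hY.point.adapted (fun u => ((measurable_rates hY hp hV hVm t u).1.sub
        (measurable_rates hY hp hV' hVm' t u).1))
      (fun k j u => ((measurable_rates hY hp hV hVm t u).2 k j).sub
        ((measurable_rates hY hp hV' hVm' t u).2 k j)))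
  refine lintegral_le_of_tendsto (fun n => ((hmeas n).pow_const 2).ennreal_ofReal) ?_
    (c := fun n => (M * Real.toNNReal (L ^ 2) : NNReal) *
      ENNReal.ofReal (B * (Real.exp (-(β * ((t : ℝ) - T / (n + 1)))) / β))) (fun n => ?_) ?_
  · filter_upwards [hbd] with ω hω
    refine ENNReal.tendsto_ofReal (Tendsto.pow ?_ 2)
    have h := (tendsto_paymentSum_rates hY hp hV t hω.1).sub
      (tendsto_paymentSum_rates hY hp hV' t hω.2)
    rw [sub_sub_sub_cancel_right] at h
    refine h.congr fun n => ?_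
    rw [paymentSum_sub]
    rfl
  · refine (hM _ _ H hHm ?_ n).trans ?_
    · filter_upwards [hbd] with ω hω u
      exact hL V V' t u ω (hV.abs_leftProcess_le hω.1 u) (hV'.abs_leftProcess_le hω.2 u)
    · have hind : ∀ u, 0 ≤ (Set.Ioi t).indicator (1 : Time T → ℝ) u := fun u =>
        Set.indicator_nonneg (fun _ _ => zero_le_one) u
      have hHsq : ∀ u, ∫⁻ ω, ENNReal.ofReal (H u ω ^ 2) ∂P ≤ ENNReal.ofReal
          (L ^ 2 * (B * ((Set.Ioi t).indicator 1 u * Real.exp (-(β * (u : Time T)))))) := by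
        intro u
        have h1 : ∀ ω, H u ω ^ 2 = (L ^ 2 * (Set.Ioi t).indicator 1 u) *
            (leftProcess V u ω - leftProcess V' u ω) ^ 2 := by
          intro ω
          have h2 : (Set.Ioi t).indicator (1 : Time T → ℝ) u ^ 2 =
              (Set.Ioi t).indicator 1 u := by
            by_cases h : u ∈ Set.Ioi t <;> simp [h]
          simp only [hH, mul_pow, sq_abs, h2]
          ring
        have h3 : 0 ≤ L ^ 2 * (Set.Ioi t).indicator (1 : Time T → ℝ) u :=
          mul_nonneg (sq_nonneg _) (hind u)
        simp_rw [h1, ENNReal.ofReal_mul h3]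
        rw [lintegral_const_mul' _ _ ENNReal.ofReal_ne_top]
        refine (mul_le_mul_right (hψ u) _).trans (le_of_eq ?_)
        rw [← ENNReal.ofReal_mul h3]
        congr 1; ring
      calc (M : ENNReal) * ∑ i ∈ Finset.range (n + 1), ENNReal.ofReal (T / (n + 1)) *
            ∫⁻ ω, ENNReal.ofReal (H (grid n i) ω ^ 2) ∂P
          ≤ M * ∑ i ∈ Finset.range (n + 1), ENNReal.ofReal (T / (n + 1)) * ENNReal.ofReal
              (L ^ 2 * (B * ((Set.Ioi t).indicator 1 (grid n i) *
                Real.exp (-(β * (grid n i : Time T)))))) := by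
            gcongr with i _
            exact hHsq _
        _ = M * ENNReal.ofReal (L ^ 2 * (B * ∑ i ∈ Finset.range (n + 1), T / (n + 1) *
              ((Set.Ioi t).indicator 1 (grid n i) *
                Real.exp (-(β * (grid n i : Time T)))))) := by
            congr 1
            rw [Finset.mul_sum, Finset.mul_sum, ENNReal.ofReal_sum_of_nonneg]
            · refine Finset.sum_congr rfl fun i _ => ?_
              rw [← ENNReal.ofReal_mul (by positivity)]
              congr 1; ring
            · intro i _
              have := hind (grid n i)
              positivity
        _ ≤ M * ENNReal.ofReal (L ^ 2 * (B *
              (Real.exp (-(β * ((t : ℝ) - T / (n + 1)))) / β))) := by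
            gcongr
            exact sum_grid_exp_le hβ t n
        _ = _ := by
            rw [ENNReal.ofReal_mul (sq_nonneg L), ENNReal.coe_mul, mul_assoc]
            rfl
  · refine ENNReal.Tendsto.const_mul (ENNReal.tendsto_ofReal ?_) (Or.inr ENNReal.coe_ne_top)
    refine Tendsto.const_mul _ (Tendsto.div_const ((Real.continuous_exp.tendsto _).comp ?_) _)
    have := (((tendsto_mesh T).const_sub (t : ℝ)).const_mul β).neg
    simpa using this

end Payments

/-! ### Uniqueness -/

section Uniqueness

variable {T : ℝ} [hT : Fact (0 < T)] {Ω : Type*} {mΩ : MeasurableSpace Ω} {P : Measure Ω}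

/-- An `L²` bound on an RCLL process passes to its left limits by Fatou's lemma. -/
lemma IsRCLL.lintegral_sq_leftProcess_le {U : Time T → Ω → ℝ} (hU : IsRCLL U)
    (hUm : ∀ t, Measurable (U t)) {b : ℝ → ℝ} (hb : Continuous b)
    (h : ∀ t : Time T, ∫⁻ ω, ENNReal.ofReal (U t ω ^ 2) ∂P ≤ ENNReal.ofReal (b t)) (t : Time T) :
    ∫⁻ ω, ENNReal.ofReal (leftProcess U t ω ^ 2) ∂P ≤ ENNReal.ofReal (b t) := by
  rcases eq_or_lt_of_le (bot_le : ⊥ ≤ t) with rfl | ht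
  · simp_rw [leftProcess_bot]
    exact h ⊥
  · refine lintegral_le_of_tendsto (f := fun n ω => ENNReal.ofReal
      (U (grid n (cellIdx n t)) ω ^ 2)) (fun n => ((hUm _).pow_const 2).ennreal_ofReal)
      (Eventually.of_forall fun ω => ENNReal.tendsto_ofReal ((hU.tendsto_grid ht ω).pow 2))
      (fun n => h _) (ENNReal.tendsto_ofReal ((hb.tendsto _).comp ?_))
    exact (continuous_subtype_val.tendsto t).comp
      (tendsto_nhdsWithin_iff.1 (tendsto_grid_cellIdx ht)).1

/-- A right-continuous process that vanishes almost surely at each time vanishes identically. -/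
lemma IsRCLL.ae_eq_zero {U : Time T → Ω → ℝ} (hU : IsRCLL U) (h : ∀ t, ∀ᵐ ω ∂P, U t ω = 0) :
    ∀ᵐ ω ∂P, ∀ t, U t ω = 0 := by
  obtain ⟨s, hsc, hsd⟩ := TopologicalSpace.exists_countable_dense (Time T)
  filter_upwards [(ae_ball_iff hsc).2 fun t _ => h t, h ⊤] with ω hω htop t
  rcases eq_or_lt_of_le (le_top : t ≤ ⊤) with rfl | ht
  · exact htop
  have hcont : Tendsto (fun u => U u ω) (𝓝[>] t) (𝓝 (U t ω)) :=
    (hU ω t).1.mono_left (nhdsWithin_mono _ Set.Ioi_subset_Ici_self)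
  have hfreq : ∃ᶠ u in 𝓝[>] t, U u ω ∈ ({0} : Set ℝ) := by
    rw [(nhdsGT_basis_of_exists_gt ⟨⊤, ht⟩).frequently_iff]
    intro b hb
    obtain ⟨u, hu, hus⟩ := hsd.exists_mem_open isOpen_Ioo (Set.nonempty_Ioo.2 hb)
    exact ⟨u, hus, hω u hu⟩
  exact isClosed_singleton.mem_of_frequently_of_tendsto hfreq hcont

end Uniqueness

end RecursiveClaim

open RecursiveClaim in
theorem lemma4p3 {Ω : Type*} {mΩ : MeasurableSpace Ω} (P : Measure Ω) [IsProbabilityMeasure P]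
    (T : ℝ) [Fact (0 < T)] (𝓕 : Filtration (Time T) mΩ) (h𝓕 : UsualConditionsTrivial 𝓕 P)
    {d r m : ℕ} (D : Set (EuclideanSpace ℝ (Fin d))) (hD_open : IsOpen D) (hD_conn : IsConnected D)
    (c : Coefficients d r m) (hc : c.Admissible T D)
    (Y : Processes T Ω d r m) (hY : IsModel D c Y 𝓕 P)
    (p : Payoff d m) (hp : p.Admissible T D)
    (Q : Measure Ω) (hQ : Q = P ∨ IsMinimalMeasure c Y 𝓕 P Q)
    (V₁ V₂ : Time T → Ω → ℝ)
    (hV₁ : IsSemimartingale 𝓕 P V₁) (hV₁_bdd : IsBoundedProcess P V₁)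
    (hV₁_eq : SolvesRecursion Y p 𝓕 Q V₁)
    (hV₂ : IsSemimartingale 𝓕 P V₂) (hV₂_bdd : IsBoundedProcess P V₂)
    (hV₂_eq : SolvesRecursion Y p 𝓕 Q V₂) :
    ∀ᵐ ω ∂P, ∀ t, V₁ t ω = V₂ t ω := by
  have h1 := hV₁.isRCLL
  have h2 := hV₂.isRCLL
  set U : Time T → Ω → ℝ := fun t ω => V₁ t ω - V₂ t ω with hU
  have hUr : IsRCLL U := h1.sub h2
  have hUm : ∀ t, Measurable[𝓕 t] (U t) := fun t => (hV₁.measurable t).sub (hV₂.measurable t)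
  have hUm' : ∀ t, Measurable (U t) := fun t => (hUm t).mono (𝓕.le t) le_rfl
  have hUl : ∀ t ω, leftProcess U t ω = leftProcess V₁ t ω - leftProcess V₂ t ω :=
    fun t ω => leftProcess_sub h1 h2 t ω
  obtain ⟨K, hK⟩ : ∃ K : ℝ, ∀ᵐ ω ∂P, ∀ t, |U t ω| ≤ K := by
    obtain ⟨K₁, hK₁⟩ := hV₁_bdd
    obtain ⟨K₂, hK₂⟩ := hV₂_bdd
    refine ⟨K₁ + K₂, ?_⟩
    filter_upwards [hK₁, hK₂] with ω h h' t
    exact (abs_sub _ _).trans (add_le_add (h t) (h' t))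
  obtain ⟨Z, hZ, hZ0, hZ2, hQZ, C, hC⟩ := hY.exists_density hc hQ
  obtain ⟨M, hM⟩ := exists_lintegral_sq_futurePayments_sub_le hY hc hp h1
    (fun t => hV₁.measurable t) hV₁_bdd h2 (fun t => hV₂.measurable t) hV₂_bdd
  have hi1 := integrable_futurePayments hY hc hp h1 (fun t => hV₁.measurable t) hV₁_bdd hZ hZ2
  have hi2 := integrable_futurePayments hY hc hp h2 (fun t => hV₂.measurable t) hV₂_bdd hZ hZ2
  have hfin : IsFiniteMeasure (P.withDensity fun ω => ENNReal.ofReal (Z ω)) := by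
    have := integrable_withDensity_of_sq (G := fun _ => 1) hZ hZ2 aemeasurable_const (by simp)
    exact (integrable_const_iff_isFiniteMeasure one_ne_zero).1 this
  have hstep1 : ∀ t, ∫⁻ ω, ENNReal.ofReal (U t ω ^ 2) ∂P ≤ C ^ 3 * ∫⁻ ω, ENNReal.ofReal
      ((futurePayments Y p V₁ t ω - futurePayments Y p V₂ t ω) ^ 2) ∂P := by
    intro t
    obtain ⟨E, hE, hE0, hR2, hRi⟩ := hC t
    refine lintegral_sq_condExp_withDensity_le (𝓕.le t) hZ hZ0 hE hE0 hR2 hRi (hUm t)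
      (K := K) (hK.mono fun ω h => h t) ?_ ((hi1 t).sub (hi2 t)) ?_
    · exact (aemeasurable_futurePayments hY hp h1 (fun t => hV₁.measurable t) hV₁_bdd t).sub
        (aemeasurable_futurePayments hY hp h2 (fun t => hV₂.measurable t) hV₂_bdd t)
    · have e1 := hV₁_eq t
      have e2 := hV₂_eq t
      rw [hQZ] at e1 e2
      exact (e1.sub e2).trans (condExp_sub (hi1 t) (hi2 t) _).symm
  -- `β` makes the map from bounds on the left limits to bounds on the process a contraction
  set β : ℝ := 2 * (C ^ 3 * M : NNReal) + 1 with hβ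
  have hβ0 : 0 < β := by positivity
  have hcontr : ∀ B : ℝ, 0 ≤ B →
      (∀ s, ∫⁻ ω, ENNReal.ofReal (leftProcess U s ω ^ 2) ∂P ≤
        ENNReal.ofReal (B * Real.exp (-(β * s)))) →
      ∀ t, ∫⁻ ω, ENNReal.ofReal (U t ω ^ 2) ∂P ≤
        ENNReal.ofReal (B / 2 * Real.exp (-(β * t))) := by
    intro B hB h t
    have h3 := hM β hβ0 B hB (fun s => by simpa only [hUl] using h s) t
    refine (hstep1 t).trans ((mul_le_mul_right h3 _).trans ?_)
    rw [← mul_assoc, ← ENNReal.coe_pow, ← ENNReal.coe_mul, ← ENNReal.ofReal_coe_nnreal,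
      ← ENNReal.ofReal_mul NNReal.zero_le_coe]
    refine ENNReal.ofReal_le_ofReal ?_
    have h4 : ((C ^ 3 * M : NNReal) : ℝ) / β ≤ 1 / 2 := by
      rw [div_le_div_iff₀ hβ0 two_pos, hβ]; linarith
    have h5 := Real.exp_pos (-(β * (t : ℝ)))
    calc ((C ^ 3 * M : NNReal) : ℝ) * (B * (Real.exp (-(β * t)) / β))
        = ((C ^ 3 * M : NNReal) : ℝ) / β * (B * Real.exp (-(β * t))) := by ring
      _ ≤ 1 / 2 * (B * Real.exp (-(β * t))) := by gcongr
      _ = B / 2 * Real.exp (-(β * t)) := by ring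
  have hiter : ∀ n : ℕ, ∀ s, ∫⁻ ω, ENNReal.ofReal (leftProcess U s ω ^ 2) ∂P ≤
      ENNReal.ofReal (K ^ 2 * Real.exp (β * T) / 2 ^ n * Real.exp (-(β * s))) := by
    intro n
    induction n with
    | zero =>
      intro s
      refine (lintegral_mono_ae (g := fun _ => ENNReal.ofReal (K ^ 2)) ?_).trans ?_
      · filter_upwards [hK] with ω hω
        refine ENNReal.ofReal_le_ofReal ?_
        rw [← sq_abs]
        exact pow_le_pow_left₀ (abs_nonneg _) (hUr.abs_leftProcess_le hω s) 2
      · rw [lintegral_const, measure_univ, mul_one]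
        refine ENNReal.ofReal_le_ofReal ?_
        rw [pow_zero, div_one, mul_assoc, ← Real.exp_add]
        refine le_mul_of_one_le_right (sq_nonneg _) (Real.one_le_exp ?_)
        have := s.2.2
        nlinarith
    | succ n ih =>
      refine hUr.lintegral_sq_leftProcess_le hUm'
        (b := fun s => K ^ 2 * Real.exp (β * T) / 2 ^ (n + 1) * Real.exp (-(β * s)))
        (by fun_prop) fun t => ?_
      refine (hcontr _ (by positivity) ih t).trans (le_of_eq ?_)
      rw [pow_succ (2 : ℝ) n, div_div]
  have hzero : ∀ t, ∀ᵐ ω ∂P, U t ω = 0 := by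
    intro t
    have hlim : Tendsto (fun n : ℕ => ENNReal.ofReal
        (K ^ 2 * Real.exp (β * T) / 2 ^ n / 2 * Real.exp (-(β * t)))) atTop (𝓝 0) := by
      rw [← ENNReal.ofReal_zero]
      refine ENNReal.tendsto_ofReal ?_
      have h3 : Tendsto (fun n : ℕ => (2 : ℝ) ^ n) atTop atTop :=
        tendsto_pow_atTop_atTop_of_one_lt one_lt_two
      have h4 := ((tendsto_const_nhds (x := K ^ 2 * Real.exp (β * T))).div_atTop h3).div_const 2
      simpa using h4.mul_const (Real.exp (-(β * t)))
    have h0 : ∫⁻ ω, ENNReal.ofReal (U t ω ^ 2) ∂P = 0 :=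
      le_antisymm (ge_of_tendsto' hlim fun n => hcontr _ (by positivity) (hiter n) t) zero_le
    rw [lintegral_eq_zero_iff ((hUm' t).pow_const 2).ennreal_ofReal] at h0
    filter_upwards [h0] with ω hω
    have h3 : U t ω ^ 2 ≤ 0 := ENNReal.ofReal_eq_zero.1 hω
    exact pow_eq_zero_iff two_ne_zero |>.1 (le_antisymm h3 (sq_nonneg _))
  filter_upwards [hUr.ae_eq_zero hzero] with ω hω t
  exact sub_eq_zero.1 (hω t)
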